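/- Let $\mathcal X_1,\mathcal X_2,\mathcal Y$ be finite alphabets and let $P(y|x_1,x_2)$ be a two-transmitter multiple-access channel. Let $p:[0,1]\to[0,1]$ be a Riemann-integrable (or, more generally, Lebesgue-integrable) function, and put $p_{\mathrm{avg}}=\int_0^1 p(t)\,dt$. The MAC with switched feedback is the following model. In a block of length $n$ there are independent switches $V_1,\dots,V_n$ with $V_i\sim\mathrm{Ber}(p_i)$, $p_i=n\int_{(i-1)/n}^{i/n}p(t)\,dt$, independent of the messages and of the channel noise. If $V_i=1$, the decoder receives the channel output $Y_{d,i}=Y_i$ and both encoders receive an erasure $Y_{e,i}=\mathsf e$; if $V_i=0$, the decoder receives $Y_{d,i}=\mathsf e$ and both encoders receive $Y_{e,i}=Y_i$. For $R_1,R_2\ge 0$, an $(n,R_1,R_2)$ code has $\lceil 2^{nR_j}\rceil$ messages for transmitter $j$, encoding functions giving $X_{j,i}=x_{j,i}(M_j,Y_e^{i-1})$ for $j=1,2$ and $i=1,\dots,n$, and a decoding function $(\hat M_1,\hat M_2)=g(Y_d^n)$; the messages $M_1,M_2$ are independent and uniform, and the error probability is $\mathbb P\{(\hat M_1,\hat M_2)\neq(M_1,M_2)\}$.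 A pair $(R_1,R_2)$ of nonnegative rates is achievable if there is a sequence of $(n,R_1,R_2)$ codes, one for each $n$, whose error probability tends to $0$ as $n\to\infty$. The capacity region $\mathcal C$ is the closure of the set of achievable rate pairs. Then for every finite alphabet $\mathcal U$ and every choice of distributions $P(u)$, $P(x_1|u)$, $P(x_2|u)$, every rate pair $(R_1,R_2)$ with $R_1,R_2\ge 0$ and $$R_1+R_2\le p_{\mathrm{avg}}\, I(X_1,X_2;Y|U),\qquad R_1\le p_{\mathrm{avg}}\, I(X_1;Y|U,X_2),\qquad R_2\le p_{\mathrm{avg}}\, I(X_2;Y|U,X_1)$$ belongs to $\mathcal C$, where the mutual informations (in bits) are those of $(U,X_1,X_2,Y)$ with joint law $P(u)P(x_1|u)P(x_2|u)P(y|x_1,x_2)$. -/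

import Mathlib

namespace SwitchedMAC

/-- Conditional mutual information `I(A;B|C)` in bits, for random variables `A`, `B`, `C` with finite
alphabets defined on a discrete probability space with law `P`:
`∑ P(a,b,c) log₂ (P(a,b,c) P(c) / (P(a,c) P(b,c)))`. Terms with `P(a,b,c) = 0` vanish. -/
noncomputable def condMutualInfo {Ω α β γ : Type*} [Fintype α] [Fintype β] [Fintype γ]
    (P : PMF Ω) (A : Ω → α) (B : Ω → β) (C : Ω → γ) : ℝ :=
  ∑ a, ∑ b, ∑ c,
    (P.map (fun ω => (A ω, B ω, C ω)) (a, b, c)).toReal *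
      Real.logb 2
        ((P.map (fun ω => (A ω, B ω, C ω)) (a, b, c)).toReal * (P.map C c).toReal /
          ((P.map (fun ω => (A ω, C ω)) (a, c)).toReal *
            (P.map (fun ω => (B ω, C ω)) (b, c)).toReal))

/-- The joint law `P(u) P(x₁|u) P(x₂|u) P(y|x₁,x₂)` of `(U, X₁, X₂, Y)`. -/
noncomputable def jointLaw {U X₁ X₂ Y : Type*} (PU : PMF U) (P₁ : U → PMF X₁) (P₂ : U → PMF X₂)
    (W : X₁ → X₂ → PMF Y) : PMF (U × X₁ × X₂ × Y) :=
  PU.bind fun u => (P₁ u).bind fun x₁ => (P₂ u).bind fun x₂ => (W x₁ x₂).map fun y => (u, x₁, x₂, y)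

/-- The average feedforward probability `∫₀¹ p(t) dt`. -/
noncomputable def pAvg (p : ℝ → ℝ) : ℝ := ∫ t in (0 : ℝ)..1, p t

/-- The feedforward probability at the time step with zero-based index `i` in blocklength `n`, i.e.
`n` times the integral of `p` over `[i/n, (i+1)/n]`. -/
noncomputable def ffProb (p : ℝ → ℝ) (n : ℕ) (i : Fin n) : ℝ :=
  (n : ℝ) * ∫ t in ((i : ℝ) / (n : ℝ))..(((i : ℝ) + 1) / (n : ℝ)), p t

/-- The probability that a `Ber(q)` variable equals `v`. -/
noncomputable def bernoulliProb (q : ℝ) (v : Bool) : ℝ := if v then q else 1 - q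

/-- The sequence received by the decoder: the channel output at feedforward times (`v i = true`),
the erasure symbol `none` at feedback times. -/
def decoderOutput {Y : Type*} {n : ℕ} (v : Fin n → Bool) (y : Fin n → Y) : Fin n → Option Y :=
  fun i => if v i then some (y i) else none

/-- The sequence fed back to both encoders: the erasure symbol `none` at feedforward times
(`v i = true`), the channel output at feedback times. -/
def encoderFeedback {Y : Type*} {n : ℕ} (v : Fin n → Bool) (y : Fin n → Y) : Fin n → Option Y :=
  fun i => if v i then none else some (y i)

/-- A code of blocklength `n` with `M₁` and `M₂` messages for the MAC with switched feedback. With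
zero-based time `i`, the encoders at time `i` see the `i` feedback symbols of times `0, …, i - 1`;
the extended output alphabet is `Option Y`, with `none` as the erasure symbol. -/
structure Code (X₁ X₂ Y : Type*) (n M₁ M₂ : ℕ) where
  /-- the encoding functions of the first transmitter -/
  enc₁ : (i : Fin n) → Fin M₁ → (Fin (i : ℕ) → Option Y) → X₁
  /-- the encoding functions of the second transmitter -/
  enc₂ : (i : Fin n) → Fin M₂ → (Fin (i : ℕ) → Option Y) → X₂
  /-- the decoding function -/
  dec : (Fin n → Option Y) → Fin M₁ × Fin M₂

/-- The part of a length-`n` sequence that precedes time `i`. -/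
def past {A : Type*} {n : ℕ} (s : Fin n → A) (i : Fin n) : Fin (i : ℕ) → A :=
  fun k => s (Fin.castLE i.isLt.le k)

namespace Code

variable {X₁ X₂ Y : Type*} {n M₁ M₂ : ℕ}

/-- The joint probability of the messages `m₁, m₂` (independent and uniform), the switch states `v`
(independent, `v i ∼ Ber(p_i)`) and the raw channel outputs `y`, when each transmitter sends the
encoding of its message and of the feedback received so far. -/
noncomputable def jointProb (c : Code X₁ X₂ Y n M₁ M₂) (W : X₁ → X₂ → PMF Y) (p : ℝ → ℝ)
    (m₁ : Fin M₁) (m₂ : Fin M₂) (v : Fin n → Bool) (y : Fin n → Y) : ℝ :=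
  (1 / (M₁ : ℝ)) * (1 / (M₂ : ℝ)) *
    ∏ i : Fin n, bernoulliProb (ffProb p n i) (v i) *
      (W (c.enc₁ i m₁ (past (encoderFeedback v y) i))
        (c.enc₂ i m₂ (past (encoderFeedback v y) i)) (y i)).toReal

/-- The probability that the decoded pair of messages differs from the transmitted pair. -/
noncomputable def errorProb [Fintype Y] (c : Code X₁ X₂ Y n M₁ M₂) (W : X₁ → X₂ → PMF Y)
    (p : ℝ → ℝ) : ℝ :=
  ∑ m₁ : Fin M₁, ∑ m₂ : Fin M₂, ∑ v : Fin n → Bool, ∑ y : Fin n → Y,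
    if c.dec (decoderOutput v y) ≠ (m₁, m₂) then c.jointProb W p m₁ m₂ v y else 0

end Code

/-- The number of messages of a rate-`R` code of blocklength `n`: `2 ^ (n R)`, rounded up. -/
noncomputable def numMessages (n : ℕ) (R : ℝ) : ℕ := ⌈(2 : ℝ) ^ ((n : ℝ) * R)⌉₊

/-- A pair of nonnegative rates is achievable for the channel `W` with feedforward probability
function `p` if there is a sequence of codes of these rates, one for each blocklength, whose error
probability tends to zero. -/
def IsAchievable {X₁ X₂ Y : Type*} [Fintype Y] (W : X₁ → X₂ → PMF Y) (p : ℝ → ℝ)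
    (R : ℝ × ℝ) : Prop :=
  0 ≤ R.1 ∧ 0 ≤ R.2 ∧
    ∃ c : (n : ℕ) → Code X₁ X₂ Y n (numMessages n R.1) (numMessages n R.2),
      Filter.Tendsto (fun n => (c n).errorProb W p) Filter.atTop (nhds 0)

/-- The capacity region: the closure of the set of achievable rate pairs. -/
def capacityRegion {X₁ X₂ Y : Type*} [Fintype Y] (W : X₁ → X₂ → PMF Y) (p : ℝ → ℝ) :
    Set (ℝ × ℝ) :=
  closure {R | IsAchievable W p R}

end SwitchedMAC

/-! Feedback is not needed: encoders that ignore it already reach the region, and what remains is a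
memoryless MAC whose output at time i is erased at the decoder with probability 1 - p_i. A
time-sharing sequence u is fixed, codewords are drawn independently with letters from P₁(·|u_i) and
P₂(·|u_i), and the decoder looks for a message pair whose likelihood on the unerased symbols is at
least T₁, T₂, T₁₂ times the likelihood under the output law given (u, x₂), (u, x₁) and u
respectively.

Exponential moments replace typicality. A wrong pair passes the relevant test with probability at
most 1/T, by a change of measure (`sum_likelihood_ge_le`). The true pair fails a test with
probability at most T^s times the s-th moment of Q/W over the unerased letters
(`sum_likelihood_lt_le`). For T = 2^(n r) this is at most exp(n (r s log 2 + p_avg (φ(s) - 1))),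
where φ is the one-letter moment; only p_avg enters because the p_i sum to n p_avg (`sum_ffProb`).
Since φ(0) = 1 and φ'(0) = -I log 2, a small s > 0 makes the exponent negative as soon as r < p_avg
I (`exists_exponent_neg`).

The one-shot union bound `exists_codebook` combines both estimates, so rates strictly below the
bounds, or equal to zero, are achievable (`isAchievable_of_lt`). Scaling by 1 - ε and taking the
closure gives the rest. -/

namespace SwitchedMAC

open Finset

/-! ### Expectations under finite product laws. -/

section FiniteSums

variable {ι A : Type*} [Fintype ι] [DecidableEq ι] [Fintype A]

theorem sum_prod_mul_apply (w : A → ℝ) (hw : ∑ x, w x = 1) (m : ι) (g : A → ℝ) :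
    ∑ f : ι → A, (∏ k, w (f k)) * g (f m) = ∑ x, w x * g x := by
  classical
  have h : ∀ f : ι → A, (∏ k, w (f k)) * g (f m) =
      ∏ k, w (f k) * (if k = m then g (f k) else 1) := by
    intro f
    rw [prod_mul_distrib, prod_ite_eq' univ m (fun k => g (f k))]
    simp
  simp_rw [h]
  rw [← Fintype.prod_sum (fun k x => w x * (if k = m then g x else 1)),
    prod_eq_single m]
  · simp
  · intro k _ hk
    simp [hk, hw]
  · simp

/-- Distinct coordinates are independent. This is applied to the codewords of the transmitted
message and of a wrong one. -/
theorem sum_prod_mul_apply_apply (w : A → ℝ) (hw : ∑ x, w x = 1) {m m' : ι} (hm : m ≠ m')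
    (g : A → A → ℝ) :
    ∑ f : ι → A, (∏ k, w (f k)) * g (f m) (f m') = ∑ x, ∑ x', w x * w x' * g x x' := by
  classical
  -- Splitting by the value x of `f m` makes the integrand a product over coordinates.
  have h : ∀ f : ι → A, (∏ k, w (f k)) * g (f m) (f m') =
      ∑ x, ∏ k, w (f k) * ((if k = m then (if f k = x then 1 else 0) else 1) *
        (if k = m' then g x (f k) else 1)) := by
    intro f
    have : ∀ x, ∏ k, w (f k) * ((if k = m then (if f k = x then 1 else 0) else 1) *
        (if k = m' then g x (f k) else 1)) =
        (∏ k, w (f k)) * ((if f m = x then 1 else 0) * g x (f m')) := by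
      intro x
      rw [prod_mul_distrib, prod_mul_distrib,
        prod_ite_eq' univ m (fun k => if f k = x then (1 : ℝ) else 0),
        prod_ite_eq' univ m' (fun k => g x (f k))]
      simp
    simp_rw [this, ← mul_sum]
    simp
  simp_rw [h]
  rw [sum_comm]
  refine sum_congr rfl fun x _ => ?_
  rw [← Fintype.prod_sum (fun k z => w z * ((if k = m then (if z = x then 1 else 0) else 1) *
        (if k = m' then g x z else 1))), prod_eq_mul m m' hm]
  · simp [hm, hm.symm, mul_sum, mul_assoc]
  · intro k _ hk
    simp [hk.1, hk.2, hw]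
  · simp
  · simp

/-- The derandomization step of random coding: some outcome is no worse than the mean. -/
theorem exists_le_of_weighted_sum_le (w g : A → ℝ) (hw0 : ∀ x, 0 ≤ w x) (hw : ∑ x, w x = 1)
    {c : ℝ} (h : ∑ x, w x * g x ≤ c) : ∃ x, g x ≤ c := by
  by_contra! hc
  have hle : ∀ x ∈ univ, w x * c ≤ w x * g x := fun x _ =>
    mul_le_mul_of_nonneg_left (hc x).le (hw0 x)
  have hpos : ∃ x, 0 < w x := by
    by_contra! h0
    have : ∑ x, w x ≤ 0 := sum_nonpos fun x _ => h0 x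
    linarith
  obtain ⟨x, hx⟩ := hpos
  have := sum_lt_sum hle ⟨x, mem_univ x, mul_lt_mul_of_pos_left (hc x) hx⟩
  rw [← sum_mul, hw] at this
  linarith

theorem sum_prod_eq_one (w : A → ℝ) (hw : ∑ x, w x = 1) : ∑ f : ι → A, ∏ k, w (f k) = 1 := by
  classical
  rw [← Fintype.prod_sum (fun _ x => w x)]
  simp [hw]

theorem weighted_sum_le (w g : A → ℝ) (hw0 : ∀ x, 0 ≤ w x) (hw : ∑ x, w x = 1) {c : ℝ}
    (h : ∀ x, g x ≤ c) : ∑ x, w x * g x ≤ c :=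
  calc ∑ x, w x * g x ≤ ∑ x, w x * c :=
        sum_le_sum fun x _ => mul_le_mul_of_nonneg_left (h x) (hw0 x)
    _ = c := by rw [← sum_mul, hw, one_mul]

/-- The wrong codeword x' is averaged last, so a bound uniform in x' is enough. The next two lemmas
do the same for the other patterns of wrong codewords. -/
theorem sum_sum_weighted_left_le {B : Type*} [Fintype B] {a : A → ℝ} {b : B → ℝ}
    (ha : ∀ x, 0 ≤ a x) (hb : ∀ x, 0 ≤ b x) (ha1 : ∑ x, a x = 1) (hb1 : ∑ x, b x = 1)
    (G : A → A → B → ℝ) {c : ℝ} (h : ∀ x' y, ∑ x, a x * G x x' y ≤ c) :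
    ∑ x, ∑ x', a x * a x' * ∑ y, b y * G x x' y ≤ c := by
  calc _ = ∑ x', a x' * ∑ y, b y * ∑ x, a x * G x x' y := by
        simp_rw [mul_sum]
        rw [sum_comm]
        refine sum_congr rfl fun x' _ => ?_
        rw [sum_comm]
        exact sum_congr rfl fun y _ => sum_congr rfl fun x _ => by ring
    _ ≤ c := weighted_sum_le _ _ ha ha1 fun x' => weighted_sum_le _ _ hb hb1 fun y => h x' y

theorem sum_sum_weighted_right_le {B : Type*} [Fintype B] {a : A → ℝ} {b : B → ℝ}
    (ha : ∀ x, 0 ≤ a x) (hb : ∀ x, 0 ≤ b x) (ha1 : ∑ x, a x = 1) (hb1 : ∑ x, b x = 1)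
    (G : A → B → B → ℝ) {c : ℝ} (h : ∀ x y', ∑ y, b y * G x y y' ≤ c) :
    ∑ x, a x * ∑ y, ∑ y', b y * b y' * G x y y' ≤ c := by
  refine weighted_sum_le _ _ ha ha1 fun x => ?_
  calc _ = ∑ y', b y' * ∑ y, b y * G x y y' := by
        simp_rw [mul_sum]
        rw [sum_comm]
        exact sum_congr rfl fun y _ => sum_congr rfl fun y' _ => by ring
    _ ≤ c := weighted_sum_le _ _ hb hb1 fun y' => h x y'

theorem sum_sum_weighted_both_le {B : Type*} [Fintype B] {a : A → ℝ} {b : B → ℝ}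
    (ha : ∀ x, 0 ≤ a x) (hb : ∀ x, 0 ≤ b x) (ha1 : ∑ x, a x = 1) (hb1 : ∑ x, b x = 1)
    (G : A → A → B → B → ℝ) {c : ℝ} (h : ∀ x' y', ∑ x, a x * ∑ y, b y * G x x' y y' ≤ c) :
    ∑ x, ∑ x', a x * a x' * ∑ y, ∑ y', b y * b y' * G x x' y y' ≤ c := by
  refine le_of_eq_of_le ?_ (sum_sum_weighted_left_le ha hb ha1 hb1
    (fun x x' y' => ∑ y, b y * G x x' y y') h)
  refine sum_congr rfl fun x _ => sum_congr rfl fun x' _ => ?_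
  rw [sum_comm]
  simp_rw [mul_sum]
  exact sum_congr rfl fun y _ => sum_congr rfl fun y' _ => by ring

end FiniteSums

/-! ### One-shot random coding with a union bound. -/

section OneShot

variable {A B Z D : Type*} [Fintype A] [Fintype B] [Fintype Z]

/-- Expectation of `F` over random codebooks with independent codewords of laws `a` and `b`. -/
noncomputable def codebookMean (a : A → ℝ) (b : B → ℝ) (M₁ M₂ : ℕ)
    (F : (Fin M₁ → A) → (Fin M₂ → B) → ℝ) : ℝ :=
  ∑ f : Fin M₁ → A, ∑ g : Fin M₂ → B, (∏ k, a (f k)) * (∏ k, b (g k)) * F f g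

theorem codebookMean_eq (a : A → ℝ) (b : B → ℝ) (M₁ M₂ : ℕ)
    (F : (Fin M₁ → A) → (Fin M₂ → B) → ℝ) : codebookMean a b M₁ M₂ F =
      ∑ f : Fin M₁ → A, (∏ k, a (f k)) * ∑ g : Fin M₂ → B, (∏ k, b (g k)) * F f g := by
  simp_rw [codebookMean, mul_sum, mul_assoc]

theorem codebookMean_sum {ι : Type*} (s : Finset ι) (a : A → ℝ) (b : B → ℝ) (M₁ M₂ : ℕ)
    (F : ι → (Fin M₁ → A) → (Fin M₂ → B) → ℝ) :
    codebookMean a b M₁ M₂ (fun f g => ∑ k ∈ s, F k f g) =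
      ∑ k ∈ s, codebookMean a b M₁ M₂ (F k) := by
  simp_rw [codebookMean, mul_sum]
  rw [sum_comm]
  simp_rw [sum_comm (s := univ) (t := s)]
  rw [sum_comm]
  simp_rw [sum_comm (s := univ) (t := s)]
  refine sum_congr rfl fun k _ => ?_
  rw [sum_comm]

theorem codebookMean_add (a : A → ℝ) (b : B → ℝ) (M₁ M₂ : ℕ)
    (F G : (Fin M₁ → A) → (Fin M₂ → B) → ℝ) :
    codebookMean a b M₁ M₂ (fun f g => F f g + G f g) =
      codebookMean a b M₁ M₂ F + codebookMean a b M₁ M₂ G := by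
  simp_rw [codebookMean, mul_add, sum_add_distrib]

theorem codebookMean_mono (a : A → ℝ) (b : B → ℝ) (ha : ∀ x, 0 ≤ a x) (hb : ∀ x, 0 ≤ b x)
    (M₁ M₂ : ℕ) {F G : (Fin M₁ → A) → (Fin M₂ → B) → ℝ} (h : ∀ f g, F f g ≤ G f g) :
    codebookMean a b M₁ M₂ F ≤ codebookMean a b M₁ M₂ G :=
  sum_le_sum fun f _ => sum_le_sum fun g _ => mul_le_mul_of_nonneg_left (h f g)
    (mul_nonneg (prod_nonneg fun _ _ => ha _) (prod_nonneg fun _ _ => hb _))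

open Classical in
/-- The decoder returns a message pair whose codewords pass the test, if there is one. -/
theorem exists_decoder {A B D : Type*} {M₁ M₂ : ℕ} (hM₁ : 0 < M₁) (hM₂ : 0 < M₂) (good : A → B → D → Prop)
    (f : Fin M₁ → A) (g : Fin M₂ → B) :
    ∃ dec : D → Fin M₁ × Fin M₂, ∀ d, (∃ m' : Fin M₁ × Fin M₂, good (f m'.1) (g m'.2) d) →
      good (f (dec d).1) (g (dec d).2) d := by
  refine ⟨fun d => if h : ∃ m' : Fin M₁ × Fin M₂, good (f m'.1) (g m'.2) d then h.choose
    else (⟨0, hM₁⟩, ⟨0, hM₂⟩), ?_⟩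
  intro d h
  simp only [h, dite_true]
  exact h.choose_spec

open Classical in
-- If the true pair passes, the decoder's answer r passes too; a wrong r differs from m in the first
-- message, the second or both, and then appears as a term of the corresponding sum.
theorem error_indicator_le {M₁ M₂ : ℕ} (good : Fin M₁ → Fin M₂ → Prop) (k : ℝ) (hk : 0 ≤ k)
    (m r : Fin M₁ × Fin M₂) (hr : (∃ m' : Fin M₁ × Fin M₂, good m'.1 m'.2) →
      good r.1 r.2) :
    (if r ≠ m then k else 0) ≤ (if good m.1 m.2 then 0 else k)
      + ∑ m₁ ∈ univ.erase m.1, (if good m₁ m.2 then k else 0)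
      + ∑ m₂ ∈ univ.erase m.2, (if good m.1 m₂ then k else 0)
      + ∑ m₁ ∈ univ.erase m.1, ∑ m₂ ∈ univ.erase m.2, (if good m₁ m₂ then k else 0) := by
  have n1 : ∀ m₁ m₂, 0 ≤ (if good m₁ m₂ then k else 0) := by
    intro m₁ m₂; split_ifs <;> simp [hk]
  have n0 : 0 ≤ (if good m.1 m.2 then 0 else k) := by split_ifs <;> simp [hk]
  have s1 : 0 ≤ ∑ m₁ ∈ univ.erase m.1, (if good m₁ m.2 then k else 0) :=
    sum_nonneg fun _ _ => n1 _ _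
  have s2 : 0 ≤ ∑ m₂ ∈ univ.erase m.2, (if good m.1 m₂ then k else 0) :=
    sum_nonneg fun _ _ => n1 _ _
  have s3 : 0 ≤ ∑ m₁ ∈ univ.erase m.1, ∑ m₂ ∈ univ.erase m.2, (if good m₁ m₂ then k else 0) :=
    sum_nonneg fun _ _ => sum_nonneg fun _ _ => n1 _ _
  by_cases hm : good m.1 m.2
  swap
  · simp only [hm, if_false]
    split_ifs <;> linarith
  by_cases hrm : r = m
  · simp only [hrm, ne_eq, not_true_eq_false, if_false]
    linarith
  have hg := hr ⟨m, hm⟩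
  rw [if_pos hrm]
  by_cases h1 : r.1 = m.1
  · have h2 : r.2 ≠ m.2 := fun h2 => hrm (Prod.ext h1 h2)
    have := single_le_sum (f := fun m₂ => if good m.1 m₂ then k else 0) (fun i _ => n1 _ _)
      (mem_erase.2 ⟨h2, mem_univ _⟩)
    rw [h1] at hg
    simp only [hg, if_true] at this
    linarith
  by_cases h2 : r.2 = m.2
  · have := single_le_sum (f := fun m₁ => if good m₁ m.2 then k else 0) (fun i _ => n1 _ _)
      (mem_erase.2 ⟨h1, mem_univ _⟩)
    rw [h2] at hg
    simp only [hg, if_true] at this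
    linarith
  · have a1 := single_le_sum (f := fun m₁ => ∑ m₂ ∈ univ.erase m.2, if good m₁ m₂ then k else 0)
      (fun i _ => sum_nonneg fun _ _ => n1 _ _) (mem_erase.2 ⟨h1, mem_univ _⟩)
    have a2 := single_le_sum (f := fun m₂ => if good r.1 m₂ then k else 0) (fun i _ => n1 _ _)
      (mem_erase.2 ⟨h2, mem_univ _⟩)
    simp only [hg, if_true] at a2
    linarith

open Classical in
/-- One-shot random coding for a two-transmitter multiple-access channel `K` whose output is
observed through `δ`, with a decoder that searches for a pair of codewords passing the test. -/
theorem exists_codebook (a : A → ℝ) (b : B → ℝ) (ha : ∀ x, 0 ≤ a x) (hb : ∀ x, 0 ≤ b x)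
    (ha1 : ∑ x, a x = 1) (hb1 : ∑ x, b x = 1) (K : A → B → Z → ℝ) (hK : ∀ x y z, 0 ≤ K x y z)
    (δ : Z → D) (good : A → B → D → Prop) {M₁ M₂ : ℕ} (hM₁ : 0 < M₁) (hM₂ : 0 < M₂)
    {ε₀ ε₁ ε₂ ε₁₂ : ℝ}
    (h₀ : ∑ x, a x * ∑ y, b y * ∑ z, (if good x y (δ z) then 0 else K x y z) ≤ ε₀)
    (h₁ : ∀ x' y, ∑ x, a x * ∑ z, (if good x' y (δ z) then K x y z else 0) ≤ ε₁)
    (h₂ : ∀ x y', ∑ y, b y * ∑ z, (if good x y' (δ z) then K x y z else 0) ≤ ε₂)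
    (h₁₂ : ∀ x' y', ∑ x, a x * ∑ y, b y * ∑ z,
      (if good x' y' (δ z) then K x y z else 0) ≤ ε₁₂) :
    ∃ (f : Fin M₁ → A) (g : Fin M₂ → B) (dec : D → Fin M₁ × Fin M₂),
      (1 / (M₁ : ℝ)) * (1 / (M₂ : ℝ)) * ∑ m₁, ∑ m₂, ∑ z,
        (if dec (δ z) ≠ (m₁, m₂) then K (f m₁) (g m₂) z else 0) ≤
      ε₀ + ((M₁ : ℝ) - 1) * ε₁ + ((M₂ : ℝ) - 1) * ε₂
        + ((M₁ : ℝ) - 1) * ((M₂ : ℝ) - 1) * ε₁₂ := by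
  replace h₁ := sum_sum_weighted_left_le ha hb ha1 hb1
    (fun x x' y => ∑ z, if good x' y (δ z) then K x y z else 0) h₁
  replace h₂ := sum_sum_weighted_right_le ha hb ha1 hb1
    (fun x y y' => ∑ z, if good x y' (δ z) then K x y z else 0) h₂
  replace h₁₂ := sum_sum_weighted_both_le ha hb ha1 hb1
    (fun x x' y y' => ∑ z, if good x' y' (δ z) then K x y z else 0) h₁₂
  choose dec hdec using fun f g => exists_decoder (A := A) (B := B) hM₁ hM₂ good f g
  -- Counting only the wrong messages gives M - 1 instead of M, so a single-message transmitter
  -- contributes no error term.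
  have hc1 : ∀ m₁ : Fin M₁, (((univ.erase m₁).card : ℕ) : ℝ) = (M₁ : ℝ) - 1 := by
    intro m; rw [card_erase_of_mem (mem_univ m), card_univ, Fintype.card_fin, Nat.cast_pred hM₁]
  have hc2 : ∀ m₁ : Fin M₂, (((univ.erase m₁).card : ℕ) : ℝ) = (M₂ : ℝ) - 1 := by
    intro m; rw [card_erase_of_mem (mem_univ m), card_univ, Fintype.card_fin, Nat.cast_pred hM₂]
  set S := ε₀ + ((M₁ : ℝ) - 1) * ε₁ + ((M₂ : ℝ) - 1) * ε₂
        + ((M₁ : ℝ) - 1) * ((M₂ : ℝ) - 1) * ε₁₂ with hS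
  have key : ∀ m : Fin M₁ × Fin M₂, codebookMean a b M₁ M₂ (fun f g => ∑ z,
      (if dec f g (δ z) ≠ m then K (f m.1) (g m.2) z else 0)) ≤ S := by
    intro m
    have hM₁' : (0 : ℝ) ≤ (M₁ : ℝ) - 1 := by rw [← hc1 m.1]; positivity
    have hM₂' : (0 : ℝ) ≤ (M₂ : ℝ) - 1 := by rw [← hc2 m.2]; positivity
    have hle := codebookMean_mono a b ha hb M₁ M₂ (fun f g => sum_le_sum (s := univ) fun z _ =>
      error_indicator_le (fun m₁ m₂ => good (f m₁) (g m₂) (δ z)) (K (f m.1) (g m.2) z)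
        (hK _ _ _) m (dec f g (δ z)) (hdec f g (δ z)))
    refine hle.trans ?_
    simp_rw [sum_add_distrib]
    rw [codebookMean_add, codebookMean_add, codebookMean_add, hS]
    gcongr ?_ + ?_ + ?_ + ?_
    · refine le_of_eq_of_le ?_ h₀
      rw [codebookMean_eq]
      rw [← sum_prod_mul_apply a ha1 m.1 (fun x => ∑ y, b y * ∑ z,
        if good x y (δ z) then 0 else K x y z)]
      refine sum_congr rfl fun f _ => ?_
      rw [← sum_prod_mul_apply b hb1 m.2
        (fun y => ∑ z, if good (f m.1) y (δ z) then 0 else K (f m.1) y z)]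
    · simp_rw [sum_comm (s := univ) (t := univ.erase m.1)]
      rw [codebookMean_sum, ← hc1 m.1, ← nsmul_eq_mul]
      refine sum_le_card_nsmul _ _ _ fun m' hm' => ?_
      refine le_of_eq_of_le ?_ h₁
      rw [codebookMean_eq]
      have := sum_prod_mul_apply_apply a ha1 (ne_of_mem_erase hm').symm (fun x x' =>
        ∑ y, b y * ∑ z, if good x' y (δ z) then K x y z else 0)
      rw [← this]
      refine sum_congr rfl fun f _ => ?_
      rw [← sum_prod_mul_apply b hb1 m.2
        (fun y => ∑ z, if good (f m') y (δ z) then K (f m.1) y z else 0)]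
    · simp_rw [sum_comm (s := univ) (t := univ.erase m.2)]
      rw [codebookMean_sum, ← hc2 m.2, ← nsmul_eq_mul]
      refine sum_le_card_nsmul _ _ _ fun m' hm' => ?_
      refine le_of_eq_of_le ?_ h₂
      rw [codebookMean_eq]
      have := sum_prod_mul_apply a ha1 m.1 (fun x =>
        ∑ y, ∑ y', b y * b y' * ∑ z, if good x y' (δ z) then K x y z else 0)
      rw [← this]
      refine sum_congr rfl fun f _ => ?_
      rw [← sum_prod_mul_apply_apply b hb1 (ne_of_mem_erase hm').symm
        (fun y y' => ∑ z, if good (f m.1) y' (δ z) then K (f m.1) y z else 0)]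
    · simp_rw [sum_comm (s := univ) (t := univ.erase m.1)]
      rw [codebookMean_sum, ← hc1 m.1, mul_assoc, ← nsmul_eq_mul]
      refine sum_le_card_nsmul _ _ _ fun m' hm' => ?_
      simp_rw [sum_comm (s := univ) (t := univ.erase m.2)]
      rw [codebookMean_sum, ← hc2 m.2, ← nsmul_eq_mul]
      refine sum_le_card_nsmul _ _ _ fun m'' hm'' => ?_
      refine le_of_eq_of_le ?_ h₁₂
      rw [codebookMean_eq]
      have := sum_prod_mul_apply_apply a ha1 (ne_of_mem_erase hm').symm (fun x x' =>
        ∑ y, ∑ y', b y * b y' * ∑ z, if good x' y' (δ z) then K x y z else 0)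
      rw [← this]
      refine sum_congr rfl fun f _ => ?_
      rw [← sum_prod_mul_apply_apply b hb1 (ne_of_mem_erase hm'').symm
        (fun y y' => ∑ z, if good (f m') y' (δ z) then K (f m.1) y z else 0)]
  have total : codebookMean a b M₁ M₂ (fun f g => ∑ m₁, ∑ m₂, ∑ z,
      (if dec f g (δ z) ≠ (m₁, m₂) then K (f m₁) (g m₂) z else 0)) ≤ (M₁ : ℝ) * (M₂ * S) := by
    rw [codebookMean_sum]
    refine (sum_le_card_nsmul _ _ ((M₂ : ℝ) * S) fun m₁ _ => ?_).trans (by simp)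
    rw [codebookMean_sum]
    exact (sum_le_card_nsmul _ _ S fun m₂ _ => key (m₁, m₂)).trans (by simp)
  rw [codebookMean_eq] at total
  obtain ⟨f, hf⟩ := exists_le_of_weighted_sum_le (fun f : Fin M₁ → A => ∏ k, a (f k)) _
    (fun f => prod_nonneg fun _ _ => ha _) (sum_prod_eq_one a ha1) total
  obtain ⟨g, hg⟩ := exists_le_of_weighted_sum_le (fun g : Fin M₂ → B => ∏ k, b (g k)) _
    (fun g => prod_nonneg fun _ _ => hb _) (sum_prod_eq_one b hb1) hf
  refine ⟨f, g, dec f g, ?_⟩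
  have p1 : (0 : ℝ) < M₁ := by exact_mod_cast hM₁
  have p2 : (0 : ℝ) < M₂ := by exact_mod_cast hM₂
  calc _ ≤ (1 / (M₁ : ℝ)) * (1 / (M₂ : ℝ)) * ((M₁ : ℝ) * (M₂ * S)) :=
        mul_le_mul_of_nonneg_left hg (by positivity)
    _ = S := by field_simp

end OneShot

/-! ### Likelihood ratio tests on partially erased outputs. -/

section Erasure

variable {Y : Type*} {n : ℕ}

/-- The likelihood of the unerased symbols of `d` under the letter weights `F`. -/
noncomputable def observedProd (F : Fin n → Y → ℝ) (d : Fin n → Option Y) : ℝ :=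
  ∏ i, (d i).elim 1 (F i)

theorem observedProd_decoderOutput (F : Fin n → Y → ℝ) (v : Fin n → Bool) (y : Fin n → Y) :
    observedProd F (decoderOutput v y) = ∏ i, if v i then F i (y i) else 1 := by
  refine prod_congr rfl fun i _ => ?_
  unfold decoderOutput
  split_ifs <;> simp

theorem bernoulliProb_nonneg {q : ℝ} (hq : q ∈ Set.Icc (0 : ℝ) 1) (v : Bool) :
    0 ≤ bernoulliProb q v := by
  unfold bernoulliProb
  split_ifs <;> linarith [hq.1, hq.2]

theorem sum_bernoulliProb (q : ℝ) : ∑ v, bernoulliProb q v = 1 := by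
  simp [bernoulliProb]

variable [Fintype Y]

theorem sum_sum_prod (h : Fin n → Bool → Y → ℝ) :
    ∑ v : Fin n → Bool, ∑ y : Fin n → Y, ∏ i, h i (v i) (y i) = ∏ i, ∑ v, ∑ y, h i v y := by
  rw [Fintype.prod_sum]
  exact sum_congr rfl fun v _ => (Fintype.prod_sum (fun i y => h i (v i) y)).symm

open Classical in
/-- Change of measure: outputs of law `Q` rarely have likelihood ratio `V / Q` above `T`. -/
theorem sum_likelihood_ge_le (Q V : Fin n → Y → ℝ) (hQ : ∀ i y, 0 ≤ Q i y)
    (hV : ∀ i y, 0 ≤ V i y) (hQ1 : ∀ i, ∑ y, Q i y = 1) (hV1 : ∀ i, ∑ y, V i y = 1)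
    (β : Fin n → ℝ) (hβ : ∀ i, β i ∈ Set.Icc (0 : ℝ) 1) {T : ℝ} (hT : 0 < T) :
    ∑ v : Fin n → Bool, ∑ y : Fin n → Y,
      (if T * observedProd Q (decoderOutput v y) ≤ observedProd V (decoderOutput v y) then
        ∏ i, bernoulliProb (β i) (v i) * Q i (y i) else 0) ≤ T⁻¹ := by
  -- The comparison law draws outputs from V at feedforward times and from Q at feedback times. Its
  -- total mass is 1, and its ratio to the true law is exactly the observed likelihood ratio.
  have hsum : ∑ v : Fin n → Bool, ∑ y : Fin n → Y,
      T⁻¹ * ∏ i, bernoulliProb (β i) (v i) * (if v i then V i (y i) else Q i (y i)) = T⁻¹ := by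
    simp_rw [← mul_sum]
    rw [sum_sum_prod (fun i v y => bernoulliProb (β i) v * (if v then V i y else Q i y))]
    rw [prod_eq_one, mul_one]
    intro i _
    rw [← sum_bernoulliProb (β i)]
    refine sum_congr rfl fun v _ => ?_
    rw [← mul_sum]
    cases v <;> simp [hQ1, hV1]
  refine le_of_le_of_eq (sum_le_sum fun v _ => sum_le_sum fun y _ => ?_) hsum
  have hb : ∀ i, 0 ≤ bernoulliProb (β i) (v i) := fun i => bernoulliProb_nonneg (hβ i) _
  split_ifs with h
  · rw [observedProd_decoderOutput, observedProd_decoderOutput] at h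
    have hC : 0 ≤ ∏ i, bernoulliProb (β i) (v i) * (if v i then 1 else Q i (y i)) := by
      refine prod_nonneg fun i _ => mul_nonneg (hb i) ?_
      split_ifs
      exacts [zero_le_one, hQ _ _]
    have e1 : ∏ i, bernoulliProb (β i) (v i) * Q i (y i) =
        (∏ i, bernoulliProb (β i) (v i) * (if v i then 1 else Q i (y i))) *
          ∏ i, (if v i then Q i (y i) else 1) := by
      rw [← prod_mul_distrib]
      refine prod_congr rfl fun i _ => ?_
      split_ifs <;> ring
    have e2 : ∏ i, bernoulliProb (β i) (v i) * (if v i then V i (y i) else Q i (y i)) =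
        (∏ i, bernoulliProb (β i) (v i) * (if v i then 1 else Q i (y i))) *
          ∏ i, (if v i then V i (y i) else 1) := by
      rw [← prod_mul_distrib]
      refine prod_congr rfl fun i _ => ?_
      split_ifs <;> ring
    rw [e1, e2, ← mul_assoc, mul_comm T⁻¹, mul_assoc]
    refine mul_le_mul_of_nonneg_left ?_ hC
    rwa [inv_mul_eq_div, le_div_iff₀ hT, mul_comm]
  · refine mul_nonneg (by positivity) (prod_nonneg fun i _ => mul_nonneg (hb i) ?_)
    split_ifs
    exacts [hV _ _, hQ _ _]

/-- The moment of order `s` of the likelihood ratio `Q / W` under the joint law `π × W`. -/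
noncomputable def ratioMoment {A : Type*} [Fintype A] (π : A → ℝ) (W Q : A → Y → ℝ) (s : ℝ) : ℝ :=
  ∑ a, ∑ y, π a * W a y * (Q a y / W a y) ^ s

open Classical in
/-- Markov's inequality for the power `s` of the likelihood ratio. -/
theorem sum_likelihood_lt_le {A : Type*} [Fintype A] (π : A → ℝ) (hπ : ∀ a, 0 ≤ π a)
    (hπ1 : ∑ a, π a = 1) (W Q : A → Y → ℝ) (hW : ∀ a y, 0 ≤ W a y)
    (hW1 : ∀ a, ∑ y, W a y = 1) (hQ : ∀ a y, 0 ≤ Q a y)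
    (β : Fin n → ℝ) (hβ : ∀ i, β i ∈ Set.Icc (0 : ℝ) 1) {T s : ℝ} (hT : 0 < T) (hs : 0 < s) :
    ∑ a : Fin n → A, (∏ i, π (a i)) * ∑ v : Fin n → Bool, ∑ y : Fin n → Y,
      (if T * observedProd (fun i => Q (a i)) (decoderOutput v y) ≤
          observedProd (fun i => W (a i)) (decoderOutput v y) then 0 else
        ∏ i, bernoulliProb (β i) (v i) * W (a i) (y i)) ≤
      T ^ s * Real.exp ((∑ i, β i) * (ratioMoment π W Q s - 1)) := by
  have hb : ∀ i v, 0 ≤ bernoulliProb (β i) v := fun i => bernoulliProb_nonneg (hβ i)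
  have point : ∀ (a : Fin n → A) (v : Fin n → Bool) (y : Fin n → Y),
      (if T * observedProd (fun i => Q (a i)) (decoderOutput v y) ≤
          observedProd (fun i => W (a i)) (decoderOutput v y) then 0 else
        ∏ i, bernoulliProb (β i) (v i) * W (a i) (y i)) ≤
      T ^ s * ∏ i, bernoulliProb (β i) (v i) * (W (a i) (y i) *
        (if v i then (Q (a i) (y i) / W (a i) (y i)) ^ s else 1)) := by
    intro a v y
    have hq : ∀ i, 0 ≤ if v i then (Q (a i) (y i) / W (a i) (y i)) ^ s else 1 := by
      intro i
      split_ifs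
      exacts [Real.rpow_nonneg (div_nonneg (hQ _ _) (hW _ _)) _, zero_le_one]
    split_ifs with h
    · exact mul_nonneg (Real.rpow_nonneg hT.le _) (prod_nonneg fun i _ =>
        mul_nonneg (hb _ _) (mul_nonneg (hW _ _) (hq i)))
    · have e : ∏ i, bernoulliProb (β i) (v i) * (W (a i) (y i) *
          (if v i then (Q (a i) (y i) / W (a i) (y i)) ^ s else 1)) =
          (∏ i, bernoulliProb (β i) (v i) * W (a i) (y i)) *
            ∏ i, (if v i then (Q (a i) (y i) / W (a i) (y i)) ^ s else 1) := by
        rw [← prod_mul_distrib]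
        exact prod_congr rfl fun i _ => (mul_assoc _ _ _).symm
      rw [e, mul_left_comm]
      -- A letter of probability zero annihilates both sides; this disposes of the conventional
      -- value of Q / 0.
      by_cases hpos : ∀ i, 0 < W (a i) (y i)
      swap
      · push Not at hpos
        obtain ⟨i, hi⟩ := hpos
        have hz : ∏ i, bernoulliProb (β i) (v i) * W (a i) (y i) = 0 :=
          prod_eq_zero (mem_univ i) (by rw [le_antisymm hi (hW _ _), mul_zero])
        rw [hz, zero_mul]
      refine le_mul_of_one_le_right (prod_nonneg fun i _ => mul_nonneg (hb _ _) (hW _ _)) ?_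
      rw [observedProd_decoderOutput, observedProd_decoderOutput, not_le] at h
      have hWp : 0 < ∏ i, (if v i then W (a i) (y i) else 1) := by
        refine prod_pos fun i _ => ?_
        split_ifs
        exacts [hpos i, one_pos]
      have e2 : ∏ i, (if v i then (Q (a i) (y i) / W (a i) (y i)) ^ s else 1) =
          ((∏ i, (if v i then Q (a i) (y i) else 1)) /
            ∏ i, (if v i then W (a i) (y i) else 1)) ^ s := by
        rw [← prod_div_distrib, ← Real.finsetProd_rpow]
        · refine prod_congr rfl fun i _ => ?_
          split_ifs <;> simp
        · intro i _
          split_ifs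
          exacts [div_nonneg (hQ _ _) (hW _ _), by norm_num]
      have hQp : 0 ≤ ∏ i, (if v i then Q (a i) (y i) else 1) := by
        refine prod_nonneg fun i _ => ?_
        split_ifs
        exacts [hQ _ _, zero_le_one]
      rw [e2, ← Real.mul_rpow hT.le (div_nonneg hQp hWp.le)]
      refine Real.one_le_rpow ?_ hs.le
      rw [← mul_div_assoc, one_le_div hWp]
      exact h.le
  calc _ ≤ ∑ a : Fin n → A, (∏ i, π (a i)) * ∑ v : Fin n → Bool, ∑ y : Fin n → Y,
        T ^ s * ∏ i, bernoulliProb (β i) (v i) * (W (a i) (y i) *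
          (if v i then (Q (a i) (y i) / W (a i) (y i)) ^ s else 1)) := by
        gcongr with a _ v _ y _
        · exact prod_nonneg fun i _ => hπ _
        · exact point a v y
    -- Letters are independent: an unerased one contributes the moment, an erased one contributes 1.
    _ = T ^ s * ∏ i, (1 + β i * (ratioMoment π W Q s - 1)) := by
        simp_rw [← mul_sum]
        have : ∀ a : Fin n → A, ∑ v : Fin n → Bool, ∑ y : Fin n → Y,
            ∏ i, bernoulliProb (β i) (v i) * (W (a i) (y i) *
              (if v i then (Q (a i) (y i) / W (a i) (y i)) ^ s else 1)) =
            ∏ i, (β i * (∑ y, W (a i) y * (Q (a i) y / W (a i) y) ^ s) + (1 - β i)) := by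
          intro a
          rw [sum_sum_prod (fun i v y => bernoulliProb (β i) v * (W (a i) y *
              (if v then (Q (a i) y / W (a i) y) ^ s else 1)))]
          refine prod_congr rfl fun i _ => ?_
          rw [Fintype.sum_bool]
          simp [bernoulliProb, ← mul_sum, hW1]
        simp_rw [this, mul_left_comm _ (T ^ s), ← mul_sum, ← prod_mul_distrib]
        rw [← Fintype.prod_sum (fun i a =>
          π a * (β i * (∑ y, W a y * (Q a y / W a y) ^ s) + (1 - β i)))]
        congr 1
        refine prod_congr rfl fun i _ => ?_
        simp_rw [mul_add, sum_add_distrib, ← sum_mul, hπ1, mul_left_comm _ (β i), ← mul_sum,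
          ratioMoment, mul_assoc, ← mul_sum]
        ring
    -- Bounding 1 + x by exp x letterwise leaves only the sum of the switch probabilities.
    _ ≤ T ^ s * Real.exp ((∑ i, β i) * (ratioMoment π W Q s - 1)) := by
        have hφ : 0 ≤ ratioMoment π W Q s :=
          sum_nonneg fun a _ => sum_nonneg fun y _ => mul_nonneg (mul_nonneg (hπ _) (hW _ _))
            (Real.rpow_nonneg (div_nonneg (hQ _ _) (hW _ _)) _)
        rw [sum_mul, Real.exp_sum]
        gcongr with i _
        · intro i _
          have := mul_nonneg (hβ i).1 hφ
          linarith [(hβ i).2]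
        · rw [add_comm]
          exact Real.add_one_le_exp _

/-- Each term of positive weight is an exponential in s with positive base, and terms of zero weight
are constant. With Q the matching output law, the derivative is minus the mutual information in
nats. -/
theorem hasDerivAt_ratioMoment {A : Type*} [Fintype A] (π : A → ℝ) (W Q : A → Y → ℝ)
    (hr : ∀ a y, π a * W a y ≠ 0 → 0 < Q a y / W a y) :
    HasDerivAt (ratioMoment π W Q)
      (∑ a, ∑ y, π a * W a y * Real.log (Q a y / W a y)) 0 := by
  unfold ratioMoment
  refine HasDerivAt.fun_sum fun a _ => HasDerivAt.fun_sum fun y _ => ?_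
  by_cases h : π a * W a y = 0
  · simpa [h] using hasDerivAt_const (0 : ℝ) (0 : ℝ)
  · have := ((hasDerivAt_id (0 : ℝ)).const_rpow (hr a y h)).const_mul (π a * W a y)
    simpa using this

/-- The exponent in Markov's inequality is negative for thresholds below the mutual information. -/
theorem exists_exponent_neg {A : Type*} [Fintype A] (π : A → ℝ) (hπ1 : ∑ a, π a = 1)
    (W Q : A → Y → ℝ) (hW1 : ∀ a, ∑ y, W a y = 1)
    (hr : ∀ a y, π a * W a y ≠ 0 → 0 < Q a y / W a y) {q r : ℝ}
    (h : r < q * ∑ a, ∑ y, π a * W a y * Real.logb 2 (W a y / Q a y)) :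
    ∃ s, 0 < s ∧ r * s * Real.log 2 + q * (ratioMoment π W Q s - 1) < 0 := by
  have hd : HasDerivAt (fun s => r * s * Real.log 2 + q * (ratioMoment π W Q s - 1))
      (r * Real.log 2 + q * ∑ a, ∑ y, π a * W a y * Real.log (Q a y / W a y)) 0 := by
    have h1 := (((hasDerivAt_id (0 : ℝ)).const_mul r).mul_const (Real.log 2)).fun_add
      (((hasDerivAt_ratioMoment π W Q hr).sub_const 1).const_mul q)
    simpa using h1
  have hlog : ∑ a, ∑ y, π a * W a y * Real.log (Q a y / W a y) =
      - Real.log 2 * ∑ a, ∑ y, π a * W a y * Real.logb 2 (W a y / Q a y) := by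
    simp_rw [mul_sum]
    refine sum_congr rfl fun a _ => sum_congr rfl fun y _ => ?_
    have : Real.log 2 ≠ 0 := (Real.log_pos one_lt_two).ne'
    rw [← inv_div, Real.log_inv, Real.logb]
    field_simp
  have hneg : r * Real.log 2 + q * ∑ a, ∑ y, π a * W a y * Real.log (Q a y / W a y) < 0 := by
    rw [hlog]
    have := mul_lt_mul_of_pos_right h (Real.log_pos one_lt_two)
    linarith
  have h0 : ratioMoment π W Q 0 = 1 := by
    simp [ratioMoment, ← mul_sum, hW1, hπ1]
  -- The exponent vanishes at s = 0 and has negative slope there, hence is negative at some s > 0.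
  have ht := hd.tendsto_slope_zero_right
  have he := ht.eventually (gt_mem_nhds hneg)
  obtain ⟨s, hs, hs0⟩ := (he.and self_mem_nhdsWithin).exists
  have hs0 : 0 < s := hs0
  refine ⟨s, hs0, ?_⟩
  simp only [zero_add, h0, sub_self, mul_zero, zero_mul, sub_zero, smul_eq_mul] at hs
  exact neg_of_mul_neg_right hs (inv_pos.2 hs0).le

end Erasure

/-! ### Switch probabilities and finite laws as real numbers. -/

section Probabilities

theorem ffProb_mem_Icc {p : ℝ → ℝ} (hp : ∀ t ∈ Set.Icc (0 : ℝ) 1, p t ∈ Set.Icc (0 : ℝ) 1)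
    (hpint : IntervalIntegrable p MeasureTheory.volume 0 1) {n : ℕ} (i : Fin n) :
    ffProb p n i ∈ Set.Icc (0 : ℝ) 1 := by
  have hn : (0 : ℝ) < n := by exact_mod_cast i.pos
  have hi : ((i : ℕ) : ℝ) + 1 ≤ n := by exact_mod_cast i.isLt
  have h0 : (0 : ℝ) ≤ (i : ℝ) / n := by positivity
  have hle : (i : ℝ) / n ≤ ((i : ℝ) + 1) / n := by gcongr; linarith
  have h1 : ((i : ℝ) + 1) / n ≤ 1 := (div_le_one hn).2 hi
  have hsub : ∀ t ∈ Set.Icc ((i : ℝ) / n) (((i : ℝ) + 1) / n), p t ∈ Set.Icc (0 : ℝ) 1 :=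
    fun t ht => hp t ⟨h0.trans ht.1, ht.2.trans h1⟩
  have hint : IntervalIntegrable p MeasureTheory.volume ((i : ℝ) / n) (((i : ℝ) + 1) / n) := by
    refine hpint.mono_set ?_
    rw [Set.uIcc_of_le hle, Set.uIcc_of_le zero_le_one]
    exact Set.Icc_subset_Icc h0 h1
  constructor
  · exact mul_nonneg hn.le (intervalIntegral.integral_nonneg hle fun t ht => (hsub t ht).1)
  · have := intervalIntegral.integral_mono_on hle hint intervalIntegrable_const
      (fun t ht => (hsub t ht).2)
    rw [intervalIntegral.integral_const, smul_eq_mul, mul_one] at this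
    calc ffProb p n i ≤ n * (((i : ℝ) + 1) / n - (i : ℝ) / n) :=
          mul_le_mul_of_nonneg_left this hn.le
      _ = 1 := by field_simp; ring

/-- The cells [i/n, (i+1)/n] tile [0, 1], so their integrals add up exactly; no regularity of p
beyond integrability is needed. -/
theorem sum_ffProb {p : ℝ → ℝ} (hpint : IntervalIntegrable p MeasureTheory.volume 0 1) (n : ℕ) :
    ∑ i, ffProb p n i = n * pAvg p := by
  rcases n.eq_zero_or_pos with rfl | hn
  · simp
  have hn' : (0 : ℝ) < n := by exact_mod_cast hn
  have := intervalIntegral.sum_integral_adjacent_intervals (f := p)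
    (μ := MeasureTheory.volume) (a := fun k : ℕ => (k : ℝ) / n) (n := n) (fun k hk => by
      refine hpint.mono_set ?_
      have hk' : ((k + 1 : ℕ) : ℝ) ≤ n := by exact_mod_cast hk
      have h0 : (0 : ℝ) ≤ (k : ℝ) / n := by positivity
      have hle : (k : ℝ) / n ≤ ((k + 1 : ℕ) : ℝ) / n := by gcongr; simp
      rw [Set.uIcc_of_le hle, Set.uIcc_of_le zero_le_one]
      exact Set.Icc_subset_Icc h0 ((div_le_one hn').2 hk'))
  simp only [Nat.cast_zero, zero_div, div_self hn'.ne', Nat.cast_add, Nat.cast_one] at this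
  rw [pAvg, ← this, ← Fin.sum_univ_eq_sum_range
    (fun k : ℕ => ∫ t in ((k : ℝ) / n)..(((k : ℝ) + 1) / n), p t), mul_sum]
  rfl

theorem sum_toReal_pmf {A : Type*} [Fintype A] (P : PMF A) : ∑ a, (P a).toReal = 1 := by
  rw [← ENNReal.toReal_sum fun a _ => P.apply_ne_top a, ← tsum_fintype (L := .unconditional A), P.tsum_coe,
    ENNReal.toReal_one]

open Classical in
theorem toReal_map_pmf {A B : Type*} [Fintype A] (P : PMF A) (f : A → B) (b : B) :
    (P.map f b).toReal = ∑ a, if b = f a then (P a).toReal else 0 := by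
  rw [PMF.map_apply, tsum_fintype, ENNReal.toReal_sum]
  · exact sum_congr rfl fun a _ => by split_ifs <;> simp
  · intro a _
    split_ifs
    exacts [P.apply_ne_top a, ENNReal.zero_ne_top]

open Classical in
theorem toReal_bind_pmf {A B : Type*} [Fintype A] (P : PMF A) (f : A → PMF B) (b : B) :
    (P.bind f b).toReal = ∑ a, (P a).toReal * (f a b).toReal := by
  rw [PMF.bind_apply, tsum_fintype, ENNReal.toReal_sum]
  · simp_rw [ENNReal.toReal_mul]
  · intro a _
    exact ENNReal.mul_ne_top (P.apply_ne_top a) ((f a).apply_ne_top b)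

end Probabilities

/-! ### Mutual informations as mean log-likelihood ratios. -/

section JointLaw

variable {U X₁ X₂ Y : Type*} [Fintype U] [Fintype X₁] [Fintype X₂] [Fintype Y]
  (PU : PMF U) (P₁ : U → PMF X₁) (P₂ : U → PMF X₂) (W : X₁ → X₂ → PMF Y)

theorem toReal_jointLaw (u : U) (x₁ : X₁) (x₂ : X₂) (y : Y) :
    (jointLaw PU P₁ P₂ W (u, x₁, x₂, y)).toReal =
      (PU u).toReal * ((P₁ u x₁).toReal * ((P₂ u x₂).toReal * (W x₁ x₂ y).toReal)) := by
  classical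
  simp only [jointLaw, toReal_bind_pmf, toReal_map_pmf, Prod.mk.injEq]
  rw [sum_eq_single u, sum_eq_single x₁, sum_eq_single x₂, sum_eq_single y]
  all_goals simp +contextual [eq_comm]

/-- The law of the output given the time-sharing letter and the second input. -/
noncomputable def outputLaw₁ (u : U) (x₂ : X₂) (y : Y) : ℝ :=
  ∑ x₁, (P₁ u x₁).toReal * (W x₁ x₂ y).toReal

/-- The law of the output given the time-sharing letter and the first input. -/
noncomputable def outputLaw₂ (u : U) (x₁ : X₁) (y : Y) : ℝ :=
  ∑ x₂, (P₂ u x₂).toReal * (W x₁ x₂ y).toReal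

/-- The law of the output given the time-sharing letter. -/
noncomputable def outputLaw₁₂ (u : U) (y : Y) : ℝ :=
  ∑ x₁, (P₁ u x₁).toReal * ∑ x₂, (P₂ u x₂).toReal * (W x₁ x₂ y).toReal

/-- The law of the time-sharing letter and the two inputs. -/
noncomputable def inputLaw (a : U × X₁ × X₂) : ℝ :=
  (PU a.1).toReal * ((P₁ a.1 a.2.1).toReal * (P₂ a.1 a.2.2).toReal)

theorem toReal_map_jointLaw {α : Type*} [DecidableEq α] (f : U × X₁ × X₂ × Y → α) (b : α) :
    ((jointLaw PU P₁ P₂ W).map f b).toReal = ∑ u, ∑ x₁, ∑ x₂, ∑ y,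
      if b = f (u, x₁, x₂, y) then
        (PU u).toReal * ((P₁ u x₁).toReal * ((P₂ u x₂).toReal * (W x₁ x₂ y).toReal)) else 0 := by
  rw [toReal_map_pmf]
  simp_rw [Fintype.sum_prod_type, toReal_jointLaw]

theorem sum_inputLaw : ∑ a, inputLaw PU P₁ P₂ a = 1 := by
  simp_rw [Fintype.sum_prod_type, inputLaw, ← mul_sum, sum_toReal_pmf, mul_one, sum_toReal_pmf,
    mul_one]
  exact sum_toReal_pmf PU

/-- Termwise cancellation in P(a,b,c) P(c) / (P(a,c) P(b,c)), with l the input probability, w the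
channel and q the output law. The factorizations are needed only where the joint probability is
nonzero; elsewhere both sides vanish. -/
theorem mul_logb_ratio_eq {j a b c d l w q : ℝ} (hj : j = l * w) (h : l * w ≠ 0 →
    c ≠ 0 ∧ b = c * q ∧ a = l ∧ d = c) :
    j * Real.logb 2 (j * d / (a * b)) = l * w * Real.logb 2 (w / q) := by
  by_cases h0 : l * w = 0
  · simp [hj, h0]
  obtain ⟨hc, hb, ha, hd⟩ := h h0
  have hl : l ≠ 0 := left_ne_zero_of_mul h0
  rw [hj, hb, ha, hd, mul_left_comm l c q, mul_assoc l w c, mul_comm w c, mul_left_comm l c w,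
    mul_div_mul_left _ _ hc, mul_div_mul_left _ _ hl]

/-- Given (u, x₂), the input x₁ still has law P₁(·|u), so `outputLaw₁` is the conditional law of Y.
The information becomes the mean of the log ratio tested by the decoder, up to sign the slope of the
moment at 0. -/
theorem condMutualInfo_jointLaw₁ :
    condMutualInfo (jointLaw PU P₁ P₂ W) (fun ω => ω.2.1) (fun ω => ω.2.2.2)
      (fun ω => (ω.1, ω.2.2.1)) =
    ∑ a : U × X₁ × X₂, ∑ y, inputLaw PU P₁ P₂ a * (W a.2.1 a.2.2 y).toReal *
      Real.logb 2 ((W a.2.1 a.2.2 y).toReal / outputLaw₁ P₁ W a.1 a.2.2 y) := by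
  classical
  simp_rw [condMutualInfo, Fintype.sum_prod_type]
  rw [sum_congr rfl fun _ _ => sum_comm, sum_comm]
  refine sum_congr rfl fun u _ => sum_congr rfl fun x₁ _ => ?_
  rw [sum_comm]
  refine sum_congr rfl fun x₂ _ => sum_congr rfl fun y _ => ?_
  refine mul_logb_ratio_eq (c := (PU u).toReal * (P₂ u x₂).toReal) ?_ fun h => ⟨?_, ?_, ?_, ?_⟩
  · rw [toReal_map_jointLaw]
    simp [ite_and, inputLaw, mul_assoc]
  · simp only [inputLaw, ne_eq, mul_eq_zero, not_or] at h ⊢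
    tauto
  · rw [toReal_map_jointLaw]
    simp only [Prod.mk.injEq, ite_and, outputLaw₁, mul_sum]
    simp
    exact sum_congr rfl fun _ _ => by ring
  · rw [toReal_map_jointLaw]
    simp [ite_and, inputLaw, ← mul_sum, sum_toReal_pmf]
  · rw [toReal_map_jointLaw]
    simp [ite_and, ← mul_sum, ← sum_mul, sum_toReal_pmf]

theorem condMutualInfo_jointLaw₂ :
    condMutualInfo (jointLaw PU P₁ P₂ W) (fun ω => ω.2.2.1) (fun ω => ω.2.2.2)
      (fun ω => (ω.1, ω.2.1)) =
    ∑ a : U × X₁ × X₂, ∑ y, inputLaw PU P₁ P₂ a * (W a.2.1 a.2.2 y).toReal *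
      Real.logb 2 ((W a.2.1 a.2.2 y).toReal / outputLaw₂ P₂ W a.1 a.2.1 y) := by
  classical
  simp_rw [condMutualInfo, Fintype.sum_prod_type]
  rw [sum_congr rfl fun _ _ => sum_comm, sum_comm]
  refine sum_congr rfl fun u _ => ?_
  rw [sum_congr rfl fun _ _ => sum_comm, sum_comm]
  refine sum_congr rfl fun x₁ _ => sum_congr rfl fun x₂ _ => sum_congr rfl fun y _ => ?_
  refine mul_logb_ratio_eq (c := (PU u).toReal * (P₁ u x₁).toReal) ?_ fun h => ⟨?_, ?_, ?_, ?_⟩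
  · rw [toReal_map_jointLaw]
    simp [ite_and, inputLaw, mul_assoc]
  · simp only [inputLaw, ne_eq, mul_eq_zero, not_or] at h ⊢
    tauto
  · rw [toReal_map_jointLaw]
    simp [ite_and, outputLaw₂, mul_sum, mul_assoc]
  · rw [toReal_map_jointLaw]
    simp [ite_and, inputLaw, ← mul_sum, sum_toReal_pmf]
  · rw [toReal_map_jointLaw]
    simp [ite_and, ← mul_sum, sum_toReal_pmf]

theorem condMutualInfo_jointLaw₁₂ :
    condMutualInfo (jointLaw PU P₁ P₂ W) (fun ω => (ω.2.1, ω.2.2.1)) (fun ω => ω.2.2.2)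
      (fun ω => ω.1) =
    ∑ a : U × X₁ × X₂, ∑ y, inputLaw PU P₁ P₂ a * (W a.2.1 a.2.2 y).toReal *
      Real.logb 2 ((W a.2.1 a.2.2 y).toReal / outputLaw₁₂ P₁ P₂ W a.1 y) := by
  classical
  simp_rw [condMutualInfo, sum_comm (s := univ (α := Y)) (t := univ (α := U))]
  rw [sum_comm]
  simp_rw [Fintype.sum_prod_type]
  refine sum_congr rfl fun u _ => sum_congr rfl fun x₁ _ => sum_congr rfl fun x₂ _ =>
    sum_congr rfl fun y _ => ?_
  refine mul_logb_ratio_eq (c := (PU u).toReal) ?_ fun h => ⟨?_, ?_, ?_, ?_⟩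
  · rw [toReal_map_jointLaw]
    simp [ite_and, inputLaw, mul_assoc]
  · simp only [inputLaw, ne_eq, mul_eq_zero, not_or] at h ⊢
    tauto
  · rw [toReal_map_jointLaw]
    simp [ite_and, outputLaw₁₂, mul_sum]
  · rw [toReal_map_jointLaw]
    simp [ite_and, inputLaw, ← mul_sum, sum_toReal_pmf]
  · rw [toReal_map_jointLaw]
    rw [sum_eq_single u (fun u' _ h => by simp [h.symm]) (by simp)]
    simp [← mul_sum, sum_toReal_pmf]

end JointLaw

/-! ### Error bound for random codes with time sharing. -/

section RandomCoding

variable {U X₁ X₂ Y : Type*} (PU : PMF U) (P₁ : U → PMF X₁) (P₂ : U → PMF X₂)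
  (W : X₁ → X₂ → PMF Y)

theorem outputLaw₁_nonneg [Fintype X₁] (u : U) (x₂ : X₂) (y : Y) : 0 ≤ outputLaw₁ P₁ W u x₂ y :=
  sum_nonneg fun _ _ => by positivity

theorem outputLaw₂_nonneg [Fintype X₂] (u : U) (x₁ : X₁) (y : Y) : 0 ≤ outputLaw₂ P₂ W u x₁ y :=
  sum_nonneg fun _ _ => by positivity

theorem outputLaw₁₂_nonneg [Fintype X₁] [Fintype X₂] (u : U) (y : Y) : 0 ≤ outputLaw₁₂ P₁ P₂ W u y :=
  sum_nonneg fun _ _ => mul_nonneg (by positivity) (sum_nonneg fun _ _ => by positivity)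

theorem sum_outputLaw₁ [Fintype X₁] [Fintype Y] (u : U) (x₂ : X₂) : ∑ y, outputLaw₁ P₁ W u x₂ y = 1 := by
  simp_rw [outputLaw₁]
  rw [sum_comm]
  simp_rw [← mul_sum, sum_toReal_pmf, mul_one, sum_toReal_pmf]

theorem sum_outputLaw₂ [Fintype X₂] [Fintype Y] (u : U) (x₁ : X₁) : ∑ y, outputLaw₂ P₂ W u x₁ y = 1 := by
  simp_rw [outputLaw₂]
  rw [sum_comm]
  simp_rw [← mul_sum, sum_toReal_pmf, mul_one, sum_toReal_pmf]

theorem outputLaw₁₂_eq [Fintype X₁] [Fintype X₂] (u : U) (y : Y) :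
    outputLaw₁₂ P₁ P₂ W u y = ∑ x₁, (P₁ u x₁).toReal * outputLaw₂ P₂ W u x₁ y := rfl

theorem sum_outputLaw₁₂ [Fintype X₁] [Fintype X₂] [Fintype Y] (u : U) : ∑ y, outputLaw₁₂ P₁ P₂ W u y = 1 := by
  simp_rw [outputLaw₁₂_eq]
  rw [sum_comm]
  simp_rw [← mul_sum, sum_outputLaw₂, mul_one, sum_toReal_pmf]

theorem inputLaw_nonneg (a : U × X₁ × X₂) : 0 ≤ inputLaw PU P₁ P₂ a := by
  unfold inputLaw; positivity

/-- The transition probabilities, with the time-sharing letter as a dummy input. -/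
noncomputable def channelLaw (U : Type*) (W : X₁ → X₂ → PMF Y) (a : U × X₁ × X₂) (y : Y) : ℝ :=
  (W a.2.1 a.2.2 y).toReal

variable [Fintype U] [Fintype X₁] [Fintype X₂] [Fintype Y]

theorem sum_pi_prod_type {n : ℕ} (F : (Fin n → U) → (Fin n → X₁) → (Fin n → X₂) → ℝ) :
    ∑ u, ∑ x₁, ∑ x₂, F u x₁ x₂ = ∑ a : Fin n → U × X₁ × X₂,
      F (fun i => (a i).1) (fun i => (a i).2.1) (fun i => (a i).2.2) := by
  refine ((Fintype.sum_equiv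
    ((Equiv.arrowProdEquivProdArrow (Fin n) (fun _ => U) fun _ => X₁ × X₂).trans
    ((Equiv.refl _).prodCongr (Equiv.arrowProdEquivProdArrow (Fin n) (fun _ => X₁) fun _ => X₂)))
    _ (fun b : (Fin n → U) × (Fin n → X₁) × (Fin n → X₂) => F b.1 b.2.1 b.2.2)
    fun a => rfl).trans ?_).symm
  simp_rw [Fintype.sum_prod_type]

open Classical in
/-- Averaging a codeword letter by letter turns the channel law into the output law. -/
theorem sum_prod_mul_sum_ite {X Z : Type*} [Fintype X] [Fintype Z] {n : ℕ} (a : Fin n → X → ℝ)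
    (K : Fin n → X → Z → ℝ) (S : (Fin n → Z) → Prop) :
    ∑ x : Fin n → X, (∏ i, a i (x i)) * ∑ z : Fin n → Z,
      (if S z then ∏ i, K i (x i) (z i) else 0) =
    ∑ z : Fin n → Z, if S z then ∏ i, ∑ x, a i x * K i x (z i) else 0 := by
  simp_rw [mul_sum]
  rw [sum_comm]
  refine sum_congr rfl fun z _ => ?_
  split_ifs
  · simp_rw [← prod_mul_distrib]
    exact (Fintype.prod_sum (fun i x => a i x * K i x (z i))).symm
  · simp

open Classical in
-- Averaged over a true codeword independent of the tested one, the output has law Q, and the change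
-- of measure applies. S need only imply the test, so it may be the conjunction of all three.
theorem sum_likelihood_ge_le_of_average {X : Type*} [Fintype X] {n : ℕ} (a : Fin n → X → ℝ)
    (K : Fin n → X → Y → ℝ) (Q V : Fin n → Y → ℝ) (hQ : ∀ i y, 0 ≤ Q i y)
    (hV : ∀ i y, 0 ≤ V i y) (hQ1 : ∀ i, ∑ y, Q i y = 1) (hV1 : ∀ i, ∑ y, V i y = 1)
    (hK : ∀ i y, ∑ x, a i x * K i x y = Q i y)
    (β : Fin n → ℝ) (hβ : ∀ i, β i ∈ Set.Icc (0 : ℝ) 1) {T : ℝ} (hT : 0 < T)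
    (S : (Fin n → Option Y) → Prop)
    (hS : ∀ d, S d → T * observedProd Q d ≤ observedProd V d) :
    ∑ x : Fin n → X, (∏ i, a i (x i)) * ∑ z : (Fin n → Bool) × (Fin n → Y),
      (if S (decoderOutput z.1 z.2) then
        ∏ i, bernoulliProb (β i) (z.1 i) * K i (x i) (z.2 i) else 0) ≤ T⁻¹ := by
  refine le_trans (le_of_eq_of_le (b := ∑ v : Fin n → Bool, ∑ y : Fin n → Y,
      if S (decoderOutput v y) then ∏ i, bernoulliProb (β i) (v i) * Q i (y i) else 0)
    ?_ (sum_le_sum fun v _ => sum_le_sum fun y _ => ?_))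
    (sum_likelihood_ge_le Q V hQ hV hQ1 hV1 β hβ hT)
  · simp_rw [Fintype.sum_prod_type, mul_sum]
    rw [sum_comm]
    refine sum_congr rfl fun v _ => ?_
    have := sum_prod_mul_sum_ite a (fun i x y => bernoulliProb (β i) (v i) * K i x y)
      (fun y => S (decoderOutput v y))
    simp_rw [mul_sum] at this
    rw [this]
    refine sum_congr rfl fun y _ => ?_
    congr 1
    refine prod_congr rfl fun i _ => ?_
    rw [← hK, mul_sum]
    exact sum_congr rfl fun x _ => mul_left_comm _ _ _
  · have h0 : 0 ≤ ∏ i, bernoulliProb (β i) (v i) * Q i (y i) :=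
      prod_nonneg fun i _ => mul_nonneg (bernoulliProb_nonneg (hβ i) _) (hQ _ _)
    by_cases h : S (decoderOutput v y)
    · rw [if_pos h, if_pos (hS _ h)]
    · rw [if_neg h]
      split_ifs
      exacts [h0, le_rfl]

open Classical in
theorem ite_le_add_of_and_imp {p q r t : Prop} (h : p ∧ q ∧ r → t) {k : ℝ} (hk : 0 ≤ k) :
    (if t then 0 else k) ≤
      (if p then 0 else k) + (if q then 0 else k) + (if r then 0 else k) := by
  by_cases hp : p <;> by_cases hq : q <;> by_cases hr : r <;> by_cases ht : t <;>
    simp [hp, hq, hr, ht] <;> first | linarith | tauto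

/-- The bound on the probability that the transmitted codewords fail a likelihood ratio test. -/
noncomputable def missBound (p : ℝ → ℝ) (n : ℕ) (Q : U × X₁ × X₂ → Y → ℝ) (T s : ℝ) : ℝ :=
  T ^ s * Real.exp (n * pAvg p * (ratioMoment (inputLaw PU P₁ P₂) (channelLaw U W) Q s - 1))

open Classical in
theorem sum_miss_le {p : ℝ → ℝ} (hp : ∀ t ∈ Set.Icc (0 : ℝ) 1, p t ∈ Set.Icc (0 : ℝ) 1)
    (hpint : IntervalIntegrable p MeasureTheory.volume 0 1) {n : ℕ}
    (Q : U × X₁ × X₂ → Y → ℝ) (hQ : ∀ a y, 0 ≤ Q a y) {T s : ℝ} (hT : 0 < T) (hs : 0 < s) :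
    ∑ u : Fin n → U, (∏ i, (PU (u i)).toReal) *
      ∑ x₁ : Fin n → X₁, (∏ i, (P₁ (u i) (x₁ i)).toReal) *
        ∑ x₂ : Fin n → X₂, (∏ i, (P₂ (u i) (x₂ i)).toReal) *
          ∑ z : (Fin n → Bool) × (Fin n → Y),
            (if T * observedProd (fun i => Q (u i, x₁ i, x₂ i)) (decoderOutput z.1 z.2) ≤
              observedProd (fun i y => (W (x₁ i) (x₂ i) y).toReal) (decoderOutput z.1 z.2) then 0
              else ∏ i, bernoulliProb (ffProb p n i) (z.1 i) *
                (W (x₁ i) (x₂ i) (z.2 i)).toReal) ≤ missBound PU P₁ P₂ W p n Q T s := by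
  have h := sum_likelihood_lt_le (inputLaw PU P₁ P₂) (inputLaw_nonneg PU P₁ P₂)
    (sum_inputLaw PU P₁ P₂) (channelLaw U W) Q (fun _ _ => ENNReal.toReal_nonneg)
    (fun _ => sum_toReal_pmf _) hQ (ffProb p n) (ffProb_mem_Icc hp hpint) hT hs
  rw [sum_ffProb hpint] at h
  refine le_of_eq_of_le ?_ h
  simp_rw [mul_sum (s := (univ : Finset (Fin n → X₁))),
    mul_sum (s := (univ : Finset (Fin n → X₂)))]
  -- The triples (u_i, x₁ᵢ, x₂ᵢ) are i.i.d. of law `inputLaw`, which is the setting of the Markov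
  -- bound.
  rw [sum_pi_prod_type]
  refine sum_congr rfl fun a _ => ?_
  rw [← mul_assoc, ← mul_assoc, Fintype.sum_prod_type, ← prod_mul_distrib, ← prod_mul_distrib]
  congr 1
  exact prod_congr rfl fun i _ => by rw [inputLaw, mul_assoc]

theorem exists_code_errorProb_le {p : ℝ → ℝ}
    (hp : ∀ t ∈ Set.Icc (0 : ℝ) 1, p t ∈ Set.Icc (0 : ℝ) 1)
    (hpint : IntervalIntegrable p MeasureTheory.volume 0 1) (n : ℕ) {M₁ M₂ : ℕ}
    (hM₁ : 0 < M₁) (hM₂ : 0 < M₂) {T₁ T₂ T₁₂ s₁ s₂ s₁₂ : ℝ} (hT₁ : 0 < T₁) (hT₂ : 0 < T₂)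
    (hT₁₂ : 0 < T₁₂) (hs₁ : 0 < s₁) (hs₂ : 0 < s₂) (hs₁₂ : 0 < s₁₂) :
    ∃ c : Code X₁ X₂ Y n M₁ M₂, c.errorProb W p ≤
      missBound PU P₁ P₂ W p n (fun a => outputLaw₁ P₁ W a.1 a.2.2) T₁ s₁ +
      missBound PU P₁ P₂ W p n (fun a => outputLaw₂ P₂ W a.1 a.2.1) T₂ s₂ +
      missBound PU P₁ P₂ W p n (fun a => outputLaw₁₂ P₁ P₂ W a.1) T₁₂ s₁₂ +
      ((M₁ : ℝ) - 1) * T₁⁻¹ + ((M₂ : ℝ) - 1) * T₂⁻¹ +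
      ((M₁ : ℝ) - 1) * ((M₂ : ℝ) - 1) * T₁₂⁻¹ := by
  classical
  let V : (Fin n → X₁) → (Fin n → X₂) → Fin n → Y → ℝ :=
    fun x₁ x₂ i y => (W (x₁ i) (x₂ i) y).toReal
  let K : (Fin n → X₁) → (Fin n → X₂) → (Fin n → Bool) × (Fin n → Y) → ℝ :=
    fun x₁ x₂ z => ∏ i, bernoulliProb (ffProb p n i) (z.1 i) * V x₁ x₂ i (z.2 i)
  let good₁ : (Fin n → U) → (Fin n → X₁) → (Fin n → X₂) → (Fin n → Option Y) → Prop :=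
    fun u x₁ x₂ d => T₁ * observedProd (fun i => outputLaw₁ P₁ W (u i) (x₂ i)) d ≤
      observedProd (V x₁ x₂) d
  let good₂ : (Fin n → U) → (Fin n → X₁) → (Fin n → X₂) → (Fin n → Option Y) → Prop :=
    fun u x₁ x₂ d => T₂ * observedProd (fun i => outputLaw₂ P₂ W (u i) (x₁ i)) d ≤
      observedProd (V x₁ x₂) d
  let good₁₂ : (Fin n → U) → (Fin n → X₁) → (Fin n → X₂) → (Fin n → Option Y) → Prop :=
    fun u x₁ x₂ d => T₁₂ * observedProd (fun i => outputLaw₁₂ P₁ P₂ W (u i)) d ≤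
      observedProd (V x₁ x₂) d
  have hβ := ffProb_mem_Icc hp hpint (n := n)
  have hK : ∀ x₁ x₂ z, 0 ≤ K x₁ x₂ z := fun x₁ x₂ z => prod_nonneg fun i _ =>
    mul_nonneg (bernoulliProb_nonneg (hβ i) _) ENNReal.toReal_nonneg
  have hmiss := add_le_add (add_le_add
    (sum_miss_le PU P₁ P₂ W hp hpint (n := n) (fun a => outputLaw₁ P₁ W a.1 a.2.2)
      (fun a y => outputLaw₁_nonneg P₁ W _ _ _) hT₁ hs₁)
    (sum_miss_le PU P₁ P₂ W hp hpint (n := n) (fun a => outputLaw₂ P₂ W a.1 a.2.1)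
      (fun a y => outputLaw₂_nonneg P₂ W _ _ _) hT₂ hs₂))
    (sum_miss_le PU P₁ P₂ W hp hpint (n := n) (fun a => outputLaw₁₂ P₁ P₂ W a.1)
      (fun a y => outputLaw₁₂_nonneg P₁ P₂ W _ _) hT₁₂ hs₁₂)
  simp only [← sum_add_distrib, ← mul_add] at hmiss
  -- The sequence u is fixed before the codebooks are drawn, as the two codewords are independent
  -- only given u. The sum of the three misses alone guides the choice: the bounds for wrong
  -- codewords hold for every u.
  obtain ⟨u, hu⟩ := exists_le_of_weighted_sum_le (fun u : Fin n → U => ∏ i, (PU (u i)).toReal) _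
    (fun u => prod_nonneg fun _ _ => ENNReal.toReal_nonneg)
    (sum_prod_eq_one _ (sum_toReal_pmf PU)) hmiss
  have ha1 : ∑ x₁ : Fin n → X₁, ∏ i, (P₁ (u i) (x₁ i)).toReal = 1 := by
    rw [← Fintype.prod_sum (fun i x => (P₁ (u i) x).toReal)]
    exact prod_eq_one fun i _ => sum_toReal_pmf _
  have hb1 : ∑ x₂ : Fin n → X₂, ∏ i, (P₂ (u i) (x₂ i)).toReal = 1 := by
    rw [← Fintype.prod_sum (fun i x => (P₂ (u i) x).toReal)]
    exact prod_eq_one fun i _ => sum_toReal_pmf _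
  refine Exists.elim (exists_codebook (fun x₁ : Fin n → X₁ => ∏ i, (P₁ (u i) (x₁ i)).toReal)
    (fun x₂ : Fin n → X₂ => ∏ i, (P₂ (u i) (x₂ i)).toReal)
    (fun _ => prod_nonneg fun _ _ => ENNReal.toReal_nonneg)
    (fun _ => prod_nonneg fun _ _ => ENNReal.toReal_nonneg) ha1 hb1 K hK
    (fun z => decoderOutput z.1 z.2)
    (fun x₁ x₂ d => good₁ u x₁ x₂ d ∧ good₂ u x₁ x₂ d ∧ good₁₂ u x₁ x₂ d) hM₁ hM₂
    (ε₀ := missBound PU P₁ P₂ W p n (fun a => outputLaw₁ P₁ W a.1 a.2.2) T₁ s₁ +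
      missBound PU P₁ P₂ W p n (fun a => outputLaw₂ P₂ W a.1 a.2.1) T₂ s₂ +
      missBound PU P₁ P₂ W p n (fun a => outputLaw₁₂ P₁ P₂ W a.1) T₁₂ s₁₂)
    (ε₁ := T₁⁻¹) (ε₂ := T₂⁻¹) (ε₁₂ := T₁₂⁻¹) ?_ ?_ ?_ ?_)
    fun f ⟨g, dec, h⟩ => ?_
  · refine le_trans (sum_le_sum fun x₁ _ => mul_le_mul_of_nonneg_left
      (sum_le_sum fun x₂ _ => mul_le_mul_of_nonneg_left (sum_le_sum fun z _ =>
        ite_le_add_of_and_imp id (hK x₁ x₂ z)) ?_) ?_) hu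
    · exact prod_nonneg fun _ _ => ENNReal.toReal_nonneg
    · exact prod_nonneg fun _ _ => ENNReal.toReal_nonneg
  · intro x₁' x₂
    exact sum_likelihood_ge_le_of_average (fun i x => (P₁ (u i) x).toReal)
      (fun i x y => (W x (x₂ i) y).toReal) (fun i => outputLaw₁ P₁ W (u i) (x₂ i)) (V x₁' x₂)
      (fun _ _ => outputLaw₁_nonneg _ _ _ _ _) (fun _ _ => ENNReal.toReal_nonneg)
      (fun _ => sum_outputLaw₁ _ _ _ _) (fun _ => sum_toReal_pmf _) (fun _ _ => rfl) _ hβ hT₁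
      (fun d => good₁ u x₁' x₂ d ∧ good₂ u x₁' x₂ d ∧ good₁₂ u x₁' x₂ d) (fun d hd => hd.1)
  · intro x₁ x₂'
    exact sum_likelihood_ge_le_of_average (fun i x => (P₂ (u i) x).toReal)
      (fun i x y => (W (x₁ i) x y).toReal) (fun i => outputLaw₂ P₂ W (u i) (x₁ i)) (V x₁ x₂')
      (fun _ _ => outputLaw₂_nonneg _ _ _ _ _) (fun _ _ => ENNReal.toReal_nonneg)
      (fun _ => sum_outputLaw₂ _ _ _ _) (fun _ => sum_toReal_pmf _) (fun _ _ => rfl) _ hβ hT₂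
      (fun d => good₁ u x₁ x₂' d ∧ good₂ u x₁ x₂' d ∧ good₁₂ u x₁ x₂' d) (fun d hd => hd.2.1)
  · intro x₁' x₂'
    -- With both codewords wrong, averaging over x₂ first turns W into `outputLaw₂`; the average
    -- over x₁ then gives `outputLaw₁₂`.
    refine le_of_eq_of_le (sum_congr rfl fun x₁ _ => ?_)
      (sum_likelihood_ge_le_of_average (fun i x => (P₁ (u i) x).toReal)
      (fun i x y => outputLaw₂ P₂ W (u i) x y) (fun i => outputLaw₁₂ P₁ P₂ W (u i)) (V x₁' x₂')
      (fun _ _ => outputLaw₁₂_nonneg _ _ _ _ _) (fun _ _ => ENNReal.toReal_nonneg)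
      (fun _ => sum_outputLaw₁₂ _ _ _ _) (fun _ => sum_toReal_pmf _) (fun _ _ => rfl) _ hβ hT₁₂
      (fun d => good₁ u x₁' x₂' d ∧ good₂ u x₁' x₂' d ∧ good₁₂ u x₁' x₂' d) (fun d hd => hd.2.2))
    congr 1
    simp_rw [Fintype.sum_prod_type, mul_sum]
    rw [sum_comm]
    refine sum_congr rfl fun v _ => ?_
    have := sum_prod_mul_sum_ite (fun i x => (P₂ (u i) x).toReal)
      (fun i x y => bernoulliProb (ffProb p n i) (v i) * (W (x₁ i) x y).toReal)
      (fun y => good₁ u x₁' x₂' (decoderOutput v y) ∧ good₂ u x₁' x₂' (decoderOutput v y) ∧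
        good₁₂ u x₁' x₂' (decoderOutput v y))
    simp_rw [mul_sum] at this
    refine this.trans (sum_congr rfl fun y _ => ?_)
    congr 1
    refine prod_congr rfl fun i _ => ?_
    rw [outputLaw₂, mul_sum]
    exact sum_congr rfl fun x _ => mul_left_comm _ _ _
  -- The encoders discard the feedback, so the output law is a product of letter laws.
  · refine ⟨⟨fun i m _ => f m i, fun i m _ => g m i, dec⟩, le_of_eq_of_le ?_ h⟩
    simp only [Code.errorProb, Code.jointProb, mul_sum, Fintype.sum_prod_type, mul_ite, mul_zero]
    rfl

end RandomCoding

/-! ### Asymptotics of message counts and thresholds. -/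

open Filter Topology

theorem numMessages_pos (n : ℕ) (R : ℝ) : 0 < numMessages n R :=
  Nat.ceil_pos.2 (by positivity)

theorem numMessages_sub_one_nonneg (n : ℕ) (R : ℝ) : 0 ≤ (numMessages n R : ℝ) - 1 := by
  have : (1 : ℝ) ≤ numMessages n R := by exact_mod_cast numMessages_pos n R
  linarith

theorem numMessages_sub_one_le (n : ℕ) (R : ℝ) :
    (numMessages n R : ℝ) - 1 ≤ (2 : ℝ) ^ ((n : ℝ) * R) := by
  have := Nat.ceil_lt_add_one (show 0 ≤ (2 : ℝ) ^ ((n : ℝ) * R) by positivity)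
  rw [numMessages]
  linarith

theorem numMessages_zero (n : ℕ) : numMessages n 0 = 1 := by simp [numMessages]

theorem tendsto_exp_nat_mul {c : ℝ} (hc : c < 0) :
    Tendsto (fun n : ℕ => Real.exp (n * c)) atTop (𝓝 0) :=
  Real.tendsto_exp_atBot.comp (tendsto_natCast_atTop_atTop.atTop_mul_const_of_neg hc)

theorem tendsto_two_rpow_nat_mul {c : ℝ} (hc : c < 0) :
    Tendsto (fun n : ℕ => (2 : ℝ) ^ ((n : ℝ) * c)) atTop (𝓝 0) := by
  have := tendsto_exp_nat_mul (mul_neg_of_pos_of_neg (Real.log_pos one_lt_two) hc)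
  refine this.congr fun n => ?_
  rw [Real.rpow_def_of_pos two_pos]
  ring_nf

/-- A rate R < J leaves room for r strictly between them. A zero rate means one message, so the
factor M - 1 vanishes and any r < J serves; this covers J = 0. -/
theorem exists_threshold {R J : ℝ} (h : R = 0 ∨ R < J) : ∃ r, r < J ∧
    Tendsto (fun n : ℕ => ((numMessages n R : ℝ) - 1) * ((2 : ℝ) ^ ((n : ℝ) * r))⁻¹)
      atTop (𝓝 0) := by
  rcases h with rfl | h
  · exact ⟨J - 1, by linarith, by simp [numMessages_zero]⟩
  · obtain ⟨r, h1, h2⟩ := exists_between h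
    refine ⟨r, h2, squeeze_zero (fun n => mul_nonneg (numMessages_sub_one_nonneg _ _)
      (by positivity)) (fun n => ?_) (tendsto_two_rpow_nat_mul (sub_neg.2 h1))⟩
    rw [mul_sub, Real.rpow_sub two_pos, div_eq_mul_inv]
    gcongr
    exact numMessages_sub_one_le n R

theorem exists_threshold_pair {R₁ R₂ J : ℝ} (h : R₁ = 0 ∨ R₂ = 0 ∨ R₁ + R₂ < J) : ∃ r, r < J ∧
    Tendsto (fun n : ℕ => ((numMessages n R₁ : ℝ) - 1) * ((numMessages n R₂ : ℝ) - 1) *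
      ((2 : ℝ) ^ ((n : ℝ) * r))⁻¹) atTop (𝓝 0) := by
  rcases h with rfl | rfl | h
  · exact ⟨J - 1, by linarith, by simp [numMessages_zero]⟩
  · exact ⟨J - 1, by linarith, by simp [numMessages_zero]⟩
  · obtain ⟨r, h1, h2⟩ := exists_between h
    refine ⟨r, h2, squeeze_zero (fun n => mul_nonneg (mul_nonneg (numMessages_sub_one_nonneg _ _)
      (numMessages_sub_one_nonneg _ _)) (by positivity)) (fun n => ?_)
      (tendsto_two_rpow_nat_mul (sub_neg.2 h1))⟩
    rw [mul_sub (n : ℝ), Real.rpow_sub two_pos, div_eq_mul_inv, mul_add, Real.rpow_add two_pos]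
    gcongr
    · exact numMessages_sub_one_nonneg _ _
    · exact numMessages_sub_one_le n R₁
    · exact numMessages_sub_one_le n R₂

theorem errorProb_nonneg {X₁ X₂ Y : Type*} [Fintype Y] (W : X₁ → X₂ → PMF Y) {p : ℝ → ℝ}
    (hp : ∀ t ∈ Set.Icc (0 : ℝ) 1, p t ∈ Set.Icc (0 : ℝ) 1)
    (hpint : IntervalIntegrable p MeasureTheory.volume 0 1) {n M₁ M₂ : ℕ}
    (c : Code X₁ X₂ Y n M₁ M₂) : 0 ≤ c.errorProb W p := by
  refine sum_nonneg fun _ _ => sum_nonneg fun _ _ => sum_nonneg fun _ _ => sum_nonneg fun _ _ => ?_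
  split_ifs
  · exact mul_nonneg (by positivity) (prod_nonneg fun i _ => mul_nonneg
      (bernoulliProb_nonneg (ffProb_mem_Icc hp hpint i) _) ENNReal.toReal_nonneg)
  · exact le_rfl

/-! ### Achievability of rates strictly inside the bounds. -/

section Achievability

variable {U X₁ X₂ Y : Type*} [Fintype U] [Fintype X₁] [Fintype X₂] [Fintype Y]
  (PU : PMF U) (P₁ : U → PMF X₁) (P₂ : U → PMF X₂) (W : X₁ → X₂ → PMF Y)

theorem exists_tendsto_missBound {p : ℝ → ℝ} (Q : U × X₁ × X₂ → Y → ℝ) {J r : ℝ}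
    (hQ : ∀ a y, inputLaw PU P₁ P₂ a * channelLaw U W a y ≠ 0 → 0 < Q a y)
    (hJ : J = ∑ a, ∑ y, inputLaw PU P₁ P₂ a * channelLaw U W a y *
      Real.logb 2 (channelLaw U W a y / Q a y)) (hr : r < pAvg p * J) :
    ∃ s, 0 < s ∧ Tendsto (fun n : ℕ => missBound PU P₁ P₂ W p n Q ((2 : ℝ) ^ ((n : ℝ) * r)) s)
      atTop (𝓝 0) := by
  rw [hJ] at hr
  obtain ⟨s, hs, h⟩ := exists_exponent_neg (inputLaw PU P₁ P₂) (sum_inputLaw PU P₁ P₂)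
    (channelLaw U W) Q (fun _ => sum_toReal_pmf _) (fun a y h => div_pos (hQ a y h)
      (lt_of_le_of_ne ENNReal.toReal_nonneg (right_ne_zero_of_mul h).symm)) hr
  refine ⟨s, hs, (tendsto_exp_nat_mul h).congr fun n => ?_⟩
  rw [missBound, ← Real.rpow_mul two_pos.le, Real.rpow_def_of_pos two_pos, ← Real.exp_add]
  ring_nf

theorem isAchievable_of_lt {p : ℝ → ℝ}
    (hp : ∀ t ∈ Set.Icc (0 : ℝ) 1, p t ∈ Set.Icc (0 : ℝ) 1)
    (hpint : IntervalIntegrable p MeasureTheory.volume 0 1) {R₁ R₂ : ℝ} (hR₁ : 0 ≤ R₁)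
    (hR₂ : 0 ≤ R₂)
    (h₁₂ : R₁ = 0 ∨ R₂ = 0 ∨ R₁ + R₂ < pAvg p * condMutualInfo (jointLaw PU P₁ P₂ W)
      (fun ω => (ω.2.1, ω.2.2.1)) (fun ω => ω.2.2.2) (fun ω => ω.1))
    (h₁ : R₁ = 0 ∨ R₁ < pAvg p * condMutualInfo (jointLaw PU P₁ P₂ W)
      (fun ω => ω.2.1) (fun ω => ω.2.2.2) (fun ω => (ω.1, ω.2.2.1)))
    (h₂ : R₂ = 0 ∨ R₂ < pAvg p * condMutualInfo (jointLaw PU P₁ P₂ W)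
      (fun ω => ω.2.2.1) (fun ω => ω.2.2.2) (fun ω => (ω.1, ω.2.1))) :
    IsAchievable W p (R₁, R₂) := by
  -- Wherever the joint law is positive, each output law contains a positive term, so the ratios Q/W
  -- there are positive.
  have hpos : ∀ (a : U × X₁ × X₂) y, inputLaw PU P₁ P₂ a * channelLaw U W a y ≠ 0 →
      0 < (P₁ a.1 a.2.1).toReal ∧ 0 < (P₂ a.1 a.2.2).toReal ∧
        0 < (W a.2.1 a.2.2 y).toReal := by
    intro a y h
    simp only [inputLaw, channelLaw, ne_eq, mul_eq_zero, not_or] at h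
    exact ⟨lt_of_le_of_ne ENNReal.toReal_nonneg (Ne.symm h.1.2.1),
      lt_of_le_of_ne ENNReal.toReal_nonneg (Ne.symm h.1.2.2),
      lt_of_le_of_ne ENNReal.toReal_nonneg (Ne.symm h.2)⟩
  obtain ⟨r₁, hr₁, ht₁⟩ := exists_threshold h₁
  obtain ⟨r₂, hr₂, ht₂⟩ := exists_threshold h₂
  obtain ⟨r₁₂, hr₁₂, ht₁₂⟩ := exists_threshold_pair h₁₂
  obtain ⟨s₁, hs₁, hm₁⟩ := exists_tendsto_missBound PU P₁ P₂ W
    (fun a => outputLaw₁ P₁ W a.1 a.2.2) (fun a y h => by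
      obtain ⟨p1, p2, p3⟩ := hpos a y h
      exact sum_pos' (fun _ _ => by positivity) ⟨a.2.1, mem_univ _, by positivity⟩)
    (condMutualInfo_jointLaw₁ PU P₁ P₂ W) hr₁
  obtain ⟨s₂, hs₂, hm₂⟩ := exists_tendsto_missBound PU P₁ P₂ W
    (fun a => outputLaw₂ P₂ W a.1 a.2.1) (fun a y h => by
      obtain ⟨p1, p2, p3⟩ := hpos a y h
      exact sum_pos' (fun _ _ => by positivity) ⟨a.2.2, mem_univ _, by positivity⟩)
    (condMutualInfo_jointLaw₂ PU P₁ P₂ W) hr₂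
  obtain ⟨s₁₂, hs₁₂, hm₁₂⟩ := exists_tendsto_missBound PU P₁ P₂ W
    (fun a => outputLaw₁₂ P₁ P₂ W a.1) (fun a y h => by
      obtain ⟨p1, p2, p3⟩ := hpos a y h
      exact sum_pos' (fun _ _ => mul_nonneg (by positivity) (outputLaw₂_nonneg P₂ W _ _ _))
        ⟨a.2.1, mem_univ _, mul_pos p1 (sum_pos' (fun _ _ => by positivity)
          ⟨a.2.2, mem_univ _, by positivity⟩)⟩)
    (condMutualInfo_jointLaw₁₂ PU P₁ P₂ W) hr₁₂
  have hcode := fun n : ℕ => exists_code_errorProb_le PU P₁ P₂ W hp hpint n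
    (numMessages_pos n R₁) (numMessages_pos n R₂)
    (T₁ := (2 : ℝ) ^ ((n : ℝ) * r₁)) (T₂ := (2 : ℝ) ^ ((n : ℝ) * r₂))
    (T₁₂ := (2 : ℝ) ^ ((n : ℝ) * r₁₂)) (by positivity) (by positivity) (by positivity)
    hs₁ hs₂ hs₁₂
  choose c hc using hcode
  refine ⟨hR₁, hR₂, c, squeeze_zero (fun n => errorProb_nonneg W hp hpint (c n)) hc ?_⟩
  simpa using ((((hm₁.add hm₂).add hm₁₂).add ht₁).add ht₂).add ht₁₂

end Achievability

end SwitchedMAC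

theorem proposition2 {U X₁ X₂ Y : Type*} [Fintype U] [Fintype X₁] [Fintype X₂] [Fintype Y]
    (W : X₁ → X₂ → PMF Y)
    (p : ℝ → ℝ) (hp : ∀ t ∈ Set.Icc (0 : ℝ) 1, p t ∈ Set.Icc (0 : ℝ) 1)
    (hpint : IntervalIntegrable p MeasureTheory.volume 0 1)
    (PU : PMF U) (P₁ : U → PMF X₁) (P₂ : U → PMF X₂)
    (R₁ R₂ : ℝ) (hR₁ : 0 ≤ R₁) (hR₂ : 0 ≤ R₂)
    (hsum : R₁ + R₂ ≤ SwitchedMAC.pAvg p *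
      SwitchedMAC.condMutualInfo (SwitchedMAC.jointLaw PU P₁ P₂ W)
        (fun ω => (ω.2.1, ω.2.2.1)) (fun ω => ω.2.2.2) (fun ω => ω.1))
    (h₁ : R₁ ≤ SwitchedMAC.pAvg p *
      SwitchedMAC.condMutualInfo (SwitchedMAC.jointLaw PU P₁ P₂ W)
        (fun ω => ω.2.1) (fun ω => ω.2.2.2) (fun ω => (ω.1, ω.2.2.1)))
    (h₂ : R₂ ≤ SwitchedMAC.pAvg p *
      SwitchedMAC.condMutualInfo (SwitchedMAC.jointLaw PU P₁ P₂ W)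
        (fun ω => ω.2.2.1) (fun ω => ω.2.2.2) (fun ω => (ω.1, ω.2.1))) :
    (R₁, R₂) ∈ SwitchedMAC.capacityRegion W p := by

  -- Shrinking a positive rate makes its bound strict; a zero rate stays zero and falls under the
  -- other alternative.
  have hscale : ∀ {R J ε : ℝ}, 0 ≤ R → R ≤ J → 0 < ε → (1 - ε) * R = 0 ∨ (1 - ε) * R < J := by
    intro R J ε hR hRJ hε
    rcases hR.eq_or_lt with rfl | hR
    · simp
    · exact Or.inr (by nlinarith)
  have hmem : ∀ ε ∈ Set.Ioo (0 : ℝ) 1,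
      ((1 - ε) * R₁, (1 - ε) * R₂) ∈ {R | SwitchedMAC.IsAchievable W p R} := by
    intro ε hε
    have h1 : 0 ≤ 1 - ε := by linarith [hε.2]
    refine SwitchedMAC.isAchievable_of_lt PU P₁ P₂ W hp hpint (mul_nonneg h1 hR₁)
      (mul_nonneg h1 hR₂) ?_ (hscale hR₁ h₁ hε.1) (hscale hR₂ h₂ hε.1)
    rcases hscale (add_nonneg hR₁ hR₂) hsum hε.1 with h | h
    · rw [mul_add] at h
      exact Or.inl (by linarith [mul_nonneg h1 hR₁, mul_nonneg h1 hR₂])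
    · rw [mul_add] at h
      exact Or.inr (Or.inr h)
  have hlim : Filter.Tendsto (fun ε : ℝ => ((1 - ε) * R₁, (1 - ε) * R₂))
      (nhdsWithin 0 (Set.Ioi 0)) (nhds (R₁, R₂)) := by
    have hcont : Continuous fun ε : ℝ => ((1 - ε) * R₁, (1 - ε) * R₂) := by fun_prop
    have := hcont.tendsto 0
    simp only [sub_zero, one_mul] at this
    exact this.mono_left nhdsWithin_le_nhds
  refine mem_closure_of_tendsto hlim ?_
  filter_upwards [Ioo_mem_nhdsGT (zero_lt_one' ℝ)] with ε hε using hmem ε hε
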